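/- Conventions. All topological groups and vector spaces are Hausdorff. Let $U$ be an open subset of a locally convex space $E$. A map $f\colon U\to F$ into a locally convex space is $C^k$, $k\in\mathbb N_0\cup\{\infty\}$, if it is continuous and, for all $1\le j\le k$, the iterated directional derivatives $(\partial_{h_j}\cdots\partial_{h_1}f)(x)$ exist and depend continuously on $(x,h_1,\dots,h_j)\in U\times E^j$. A Fréchet–Lie group is a group $G$ with a smooth ($C^\infty$) manifold structure modeled on a Fréchet space for which multiplication and inversion are smooth; its Lie algebra is $\mathfrak g=T_{\mathbf 1}(G)$. It has the Trotter property if it has a smooth exponential function $\exp\colon\mathfrak g\to G$ (every $t\mapsto\exp(tx)$ is a one-parameter group with velocity $x$ at $t=0$) and, for all $x_1,x_2\in\mathfrak g$, $$\exp(t(x_1+x_2))=\lim_{n\to\infty}\Big(\exp\big(\tfrac tn x_1\big)\exp\big(\tfrac tn x_2\big)\Big)^n$$ uniformly for $t$ in compact subsets of $\mathbb R$. For a unitary representation $\pi$ of $G$ on a complex Hilbert space $\mathcal H$, let $\mathcal H^k$, $k\in\mathbb N_0\cup\{\infty\}$, be the set of $C^k$-vectors, i.e. of those $v\in\mathcal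 H$ whose orbit map $G\to\mathcal H$, $g\mapsto\pi(g)v$, is $C^k$. For $x\in\mathfrak g$ let $\mathcal D_x$ be the set of those $v\in\mathcal H$ for which $\overline{\mathrm d\pi}(x)v:=\frac{d}{dt}\big|_{t=0}\pi(\exp(tx))v$ exists. Put $\mathcal D^0:=\mathcal H$, $\mathcal D^1:=\bigcap_{x\in\mathfrak g}\mathcal D_x$, $$\mathcal D^n:=\{v\in\mathcal D^1 : \overline{\mathrm d\pi}(x)v\in\mathcal D^{n-1}\text{ for all }x\in\mathfrak g\}\quad (n>1),\qquad \mathcal D^\infty:=\bigcap_{n\in\mathbb N}\mathcal D^n .$$ Theorem. Let $G$ be a Fréchet–Lie group with the Trotter property and let $(\pi,\mathcal H)$ be a unitary representation of $G$ that is differentiable, i.e. $\mathcal H^1$ is dense in $\mathcal H$. Then $\mathcal D^n=\mathcal H^n$ for every $n\in\mathbb N_0\cup\{\infty\}$. -/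

import Mathlib

open Filter Topology

section Calculus

variable {E F : Type*} [AddCommGroup E] [Module ℝ E] [TopologicalSpace E]
  [AddCommGroup F] [Module ℝ F] [TopologicalSpace F]

/-- `f` has at `x` the derivative `l = lim_{t → 0} t⁻¹ (f (x + t h) - f x)` in the direction `h`. -/
def HasDirDerivAt (f : E → F) (l : F) (x h : E) : Prop :=
  Tendsto (fun t : ℝ => t⁻¹ • (f (x + t • h) - f x)) (𝓝[≠] 0) (𝓝 l)

/-- `f` is a `C^k`-map on the (open) set `U`, for `k ∈ ℕ ∪ {∞}`, in the sense of calculus on locally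
convex spaces: `f` is continuous on `U`, the iterated directional derivatives
`D j x (h₁, …, h_j) = (∂_{h_j} ⋯ ∂_{h₁} f) x` exist for `j ≤ k` and `x ∈ U`, and all the maps
`D j : U × E^j → F` are continuous. -/
def IsCkOn (k : ℕ∞) (f : E → F) (U : Set E) : Prop :=
  ∃ D : (j : ℕ) → E → (Fin j → E) → F,
    (∀ x ∈ U, ∀ h : Fin 0 → E, D 0 x h = f x) ∧
    (∀ j : ℕ, ((j + 1 : ℕ) : ℕ∞) ≤ k → ∀ x ∈ U, ∀ (h : Fin j → E) (h' : E),
      HasDirDerivAt (fun y => D j y h) (D (j + 1) x (Fin.snoc h h')) x h') ∧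
    (∀ j : ℕ, (j : ℕ∞) ≤ k →
      ContinuousOn (fun p : E × (Fin j → E) => D j p.1 p.2) (U ×ˢ Set.univ))

end Calculus

section Manifolds

/-- A continuous map between manifolds modeled on locally convex spaces is `C^k` if it is `C^k`
in all charts. Vector spaces carry the atlas consisting of the identity. -/
def IsCkMap (E F : Type*) {M N : Type*}
    [AddCommGroup E] [Module ℝ E] [TopologicalSpace E]
    [AddCommGroup F] [Module ℝ F] [TopologicalSpace F]
    [TopologicalSpace M] [ChartedSpace E M] [TopologicalSpace N] [ChartedSpace F N]
    (k : ℕ∞) (f : M → N) : Prop :=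
  Continuous f ∧ ∀ e ∈ atlas E M, ∀ e' ∈ atlas F N,
    IsCkOn k (fun x => e' (f (e.symm x))) (e.target ∩ e.symm ⁻¹' (f ⁻¹' e'.source))

/-- The group `G`, with its atlas of charts with values in the locally convex space `E`, is a Lie
group: the changes of charts are smooth (so that `G` is a smooth manifold) and the group operations
are smooth. The product manifold `G × G` is described by the products of charts of `G`; continuity
of the operations is contained in `IsTopologicalGroup G`. -/
structure IsLCLieGroup (E G : Type*) [AddCommGroup E] [Module ℝ E] [TopologicalSpace E]
    [Group G] [TopologicalSpace G] [IsTopologicalGroup G] [ChartedSpace E G] : Prop where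
  smooth_charts : ∀ e ∈ atlas E G, ∀ e' ∈ atlas E G,
    IsCkOn ⊤ (fun x => e' (e.symm x)) (e.target ∩ e.symm ⁻¹' e'.source)
  smooth_mul : ∀ e₁ ∈ atlas E G, ∀ e₂ ∈ atlas E G, ∀ e₃ ∈ atlas E G,
    IsCkOn ⊤ (fun p : E × E => e₃ (e₁.symm p.1 * e₂.symm p.2))
      {p : E × E | p.1 ∈ e₁.target ∧ p.2 ∈ e₂.target ∧ e₁.symm p.1 * e₂.symm p.2 ∈ e₃.source}
  smooth_inv : IsCkMap E E ⊤ (fun g : G => g⁻¹)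

variable {E G : Type*} [AddCommGroup E] [Module ℝ E] [TopologicalSpace E]
  [Group G] [TopologicalSpace G] [ChartedSpace E G]

/-- `exp : 𝔤 → G` is a (smooth) exponential function of `G`. The Lie algebra `𝔤 = T_1 G` is, as a
topological vector space, the model space `E`: the velocity at time `0` of a curve `γ` with
`γ 0 = 1` is identified with that of its image under the preferred chart `φ` at `1`. Every curve
`t ↦ exp (t x)` is a one-parameter group with velocity `x` at `t = 0`. -/
structure IsExponential (exp : E → G) : Prop where
  smooth : IsCkMap E E ⊤ exp
  add_smul : ∀ (x : E) (s t : ℝ), exp ((s + t) • x) = exp (s • x) * exp (t • x)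
  velocity : ∀ x : E,
    Tendsto (fun t : ℝ => t⁻¹ • (chartAt E (1 : G) (exp (t • x)) - chartAt E (1 : G) 1))
      (𝓝[≠] 0) (𝓝 x)

/-- The Lie group `G` has the Trotter property, with smooth exponential function `exp`:
`exp (t (x₁ + x₂)) = lim_n (exp ((t/n) x₁) exp ((t/n) x₂)) ^ n` uniformly for `t` in compact
subsets of `ℝ`, for all `x₁, x₂ ∈ 𝔤`. -/
structure HasTrotterProperty (exp : E → G) : Prop where
  isExponential : IsExponential exp
  trotter : ∀ x₁ x₂ : E, ∀ K : Set ℝ, IsCompact K → ∀ U ∈ 𝓝 (1 : G), ∀ᶠ n : ℕ in atTop,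
    ∀ t ∈ K, (exp (t • (x₁ + x₂)))⁻¹ *
      (exp ((t / n) • x₁) * exp ((t / n) • x₂)) ^ n ∈ U

end Manifolds

section Representations

variable {E G H : Type*} [AddCommGroup E] [Module ℝ E] [TopologicalSpace E]
  [Group G] [TopologicalSpace G] [ChartedSpace E G]
  [NormedAddCommGroup H] [InnerProductSpace ℂ H]

/-- The set `H^k` of `C^k`-vectors of the unitary representation `π`: the vectors whose orbit map
`g ↦ π g v` is a `C^k`-map from `G` to (the real vector space underlying) `H`. -/
def ckVectors (E : Type*) [AddCommGroup E] [Module ℝ E] [TopologicalSpace E] [ChartedSpace E G]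
    (π : G →* (H ≃ₗᵢ[ℂ] H)) (k : ℕ∞) : Set H :=
  {v | IsCkMap E H k (fun g => π g v)}

/-- The domain `D_x` of the infinitesimal generator of the one-parameter group
`t ↦ π (exp (t x))`. -/
def generatorDomain (π : G →* (H ≃ₗᵢ[ℂ] H)) (exp : E → G) (x : E) : Set H :=
  {v | DifferentiableAt ℝ (fun t : ℝ => π (exp (t • x)) v) 0}

/-- The infinitesimal generator `dπ(x) v = d/dt|_{t = 0} π (exp (t x)) v`, used only for `v` in
`generatorDomain π exp x`. -/
noncomputable def generator (π : G →* (H ≃ₗᵢ[ℂ] H)) (exp : E → G) (x : E) (v : H) : H :=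
  deriv (fun t : ℝ => π (exp (t • x)) v) 0

/-- The spaces `D^n`: `D^0 = H`, `D^1 = ⋂ₓ D_x` and
`D^n = {v ∈ D^1 | dπ(x) v ∈ D^{n-1} for all x}` for `n > 1`. -/
def generatorDomains (π : G →* (H ≃ₗᵢ[ℂ] H)) (exp : E → G) : ℕ → Set H
  | 0 => Set.univ
  | n + 1 => {v | v ∈ (⋂ x : E, generatorDomain π exp x) ∧
      ∀ x : E, generator π exp x v ∈ generatorDomains π exp n}

end Representations

/-! A dense set of C^1-vectors gives weak control over all generators. For w in H^1 the map y ↦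
dπ(y)w is the differential of a C^1 orbit map, hence linear and continuous, and unitarity gives ⟨w,
dπ(y)u⟩ = -⟨dπ(y)w, u⟩ for u in D_y (`IsExponential.inner_generator`). Testing against the dense set
H^1 shows that y ↦ dπ(y)u is linear and weakly continuous for u in D^1; since a Fréchet space is
barrelled, it is norm continuous (`continuous_of_continuous_inner`). Repeating this,
dπ(y_j)⋯dπ(y_1)v with v in D^n and j ≤ n is multilinear and separately continuous in y, hence
jointly continuous by Banach–Steinhaus (`IsMultilinear.continuous_of_separately`).

For the inverse σ of a chart put D_j(x, y) = π(σ x) dπ(y_j)⋯dπ(y_1)v. A weak derivative that is norm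
continuous is a norm derivative (`hasDerivAt_of_weak`), so ∂_h D_j(x, y) = D_{j+1}(x, y, κ(x, h))
with κ the smooth left logarithmic derivative of σ (`IsLCLieGroup.hasDirDerivAt_orbit`). In such a
closed system of multilinear maps, continuity of D_0, …, D_n already makes D_0 of class C^n
(`tangentCkOn_of_multilinear`). Thus D^n ⊆ H^n.

Conversely, for v in H^{n+1} the map x ↦ π(σ x) dπ(y)v is the t-derivative at 0 of the C^{n+1}-map
(x, t) ↦ π(σ x exp(ty))v. Hence dπ(y)v lies in H^n, and H^n ⊆ D^n by induction.

The calculus runs on the recursive notion `TangentCkOn`, for which the chain rule is a direct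
induction; `isCkOn_iff_tangentCkOn` translates. -/

set_option linter.unusedSectionVars false

universe u v w

/-! ### Elementary rules for directional derivatives. -/

section DirectionalDerivatives

variable {E E' F G : Type*}
  [AddCommGroup E] [Module ℝ E] [TopologicalSpace E]
  [AddCommGroup E'] [Module ℝ E'] [TopologicalSpace E']
  [AddCommGroup F] [Module ℝ F] [TopologicalSpace F]
  [AddCommGroup G] [Module ℝ G] [TopologicalSpace G]

/-- The total derivative `(x, h) ↦ ∂_h f x` of `f` (with a junk value where it does not exist). -/
noncomputable def dirDeriv (f : E → F) (p : E × E) : F :=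
  limUnder (𝓝[≠] (0 : ℝ)) (fun t : ℝ => t⁻¹ • (f (p.1 + t • p.2) - f p.1))

theorem HasDirDerivAt.dirDeriv_eq [T2Space F] {f : E → F} {l : F} {x h : E}
    (H : HasDirDerivAt f l x h) : dirDeriv f (x, h) = l :=
  H.limUnder_eq

theorem HasDirDerivAt.smul [ContinuousConstSMul ℝ F] {f : E → F} {l : F} {x h : E}
    (H : HasDirDerivAt f l x h) (c : ℝ) : HasDirDerivAt f (c • l) x (c • h) := by
  rcases eq_or_ne c 0 with rfl | hc
  · simp only [HasDirDerivAt, zero_smul, smul_zero, add_zero, sub_self]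
    exact tendsto_const_nhds
  · have h1 : Tendsto (fun t : ℝ => t * c) (𝓝[≠] 0) (𝓝[≠] 0) := by
      refine tendsto_nhdsWithin_iff.2 ⟨?_, ?_⟩
      · exact ((continuous_mul_const c).tendsto' 0 0 (zero_mul c)).mono_left nhdsWithin_le_nhds
      · filter_upwards [self_mem_nhdsWithin] with t ht
        exact mul_ne_zero ht hc
    refine ((Tendsto.comp H h1).const_smul c).congr fun t => ?_
    simp only [Function.comp, smul_smul, mul_inv_rev, mul_inv_cancel_left₀ hc]

theorem tendsto_line [ContinuousAdd E] [ContinuousSMul ℝ E] (x h : E) :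
    Tendsto (fun t : ℝ => x + t • h) (𝓝 0) (𝓝 x) := by
  have : Continuous fun t : ℝ => x + t • h := by fun_prop
  simpa using this.tendsto 0

theorem HasDirDerivAt.congr_of_eventuallyEq [ContinuousAdd E] [ContinuousSMul ℝ E]
    {f g : E → F} {l : F} {x h : E} (H : HasDirDerivAt f l x h) (hfg : f =ᶠ[𝓝 x] g) :
    HasDirDerivAt g l x h := by
  refine Tendsto.congr' ?_ H
  filter_upwards [((tendsto_line x h).eventually hfg).filter_mono nhdsWithin_le_nhds] with t ht
  rw [ht, hfg.eq_of_nhds]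

theorem HasDirDerivAt.prodMk {f : E → F} {g : E → G} {l : F} {m : G} {x h : E}
    (hf : HasDirDerivAt f l x h) (hg : HasDirDerivAt g m x h) :
    HasDirDerivAt (fun y => (f y, g y)) (l, m) x h :=
  Tendsto.prodMk_nhds hf hg

theorem HasDirDerivAt.clm_comp {f : E → F} {l : F} {x h : E}
    (hf : HasDirDerivAt f l x h) (L : F →L[ℝ] G) :
    HasDirDerivAt (fun y => L (f y)) (L l) x h := by
  refine ((L.continuous.tendsto l).comp hf).congr fun t => ?_
  simp

theorem HasDirDerivAt.comp_clm (L : E →L[ℝ] E') {f : E' → F} {l : F} {x h : E}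
    (hf : HasDirDerivAt f l (L x) (L h)) : HasDirDerivAt (fun y => f (L y)) l x h := by
  refine Tendsto.congr (fun t => ?_) hf
  simp

theorem ContinuousLinearMap.hasDirDerivAt (L : E →L[ℝ] F) (x h : E) :
    HasDirDerivAt L (L h) x h := by
  refine tendsto_const_nhds.congr' ?_
  filter_upwards [self_mem_nhdsWithin] with t ht
  simp [smul_smul, inv_mul_cancel₀ (show t ≠ 0 from ht)]

theorem hasDirDerivAt_iff_hasDerivAt {V : Type*} [NormedAddCommGroup V] [NormedSpace ℝ V]
    {f : ℝ → V} {l : V} {x : ℝ} : HasDirDerivAt f l x 1 ↔ HasDerivAt f l x := by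
  rw [hasDerivAt_iff_tendsto_slope_zero]
  simp [HasDirDerivAt]

end DirectionalDerivatives

/-! ### The mean value theorem in locally convex spaces. -/

section MeanValue

variable {F G : Type*}
  [AddCommGroup F] [Module ℝ F] [TopologicalSpace F]
  [AddCommGroup G] [Module ℝ G] [TopologicalSpace G]
  [IsTopologicalAddGroup G] [ContinuousSMul ℝ G] [LocallyConvexSpace ℝ G]

/-- Mean value theorem: a curve whose velocities lie in a closed convex set `B` has its increment
over `[0, 1]` in `B`. -/
theorem sub_mem_of_velocity_mem {c c' : ℝ → G} {B : Set G} (hB : Convex ℝ B) (hBc : IsClosed B)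
    (hc : ∀ s ∈ Set.Icc (0 : ℝ) 1, HasDirDerivAt c (c' s) s 1)
    (hc' : ∀ s ∈ Set.Icc (0 : ℝ) 1, c' s ∈ B) : c 1 - c 0 ∈ B := by
  by_contra hmem
  -- A functional separating the increment from `B` contradicts the scalar mean value theorem.
  obtain ⟨f, r, hr, hr'⟩ := geometric_hahn_banach_closed_point hB hBc hmem
  have hd : ∀ s ∈ Set.Icc (0 : ℝ) 1, HasDerivAt (fun s => f (c s)) (f (c' s)) s := fun s hs =>
    hasDirDerivAt_iff_hasDerivAt.1 ((hc s hs).clm_comp f)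
  obtain ⟨s, hs, hs'⟩ := exists_hasDerivAt_eq_slope (fun s => f (c s)) (fun s => f (c' s))
    zero_lt_one (fun s hs => (hd s hs).continuousAt.continuousWithinAt)
    (fun s hs => hd s (Set.Ioo_subset_Icc_self hs))
  have := hr _ (hc' s (Set.Ioo_subset_Icc_self hs))
  simp only [sub_zero, div_one] at hs'
  rw [hs', ← map_sub] at this
  exact lt_asymm this hr'

theorem exists_isClosed_convex_subset {z : G} {N : Set G} (hN : N ∈ 𝓝 z) :
    ∃ B ∈ 𝓝 z, IsClosed B ∧ Convex ℝ B ∧ B ⊆ N := by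
  obtain ⟨N', ⟨hN', hN'c⟩, hsub⟩ := (closed_nhds_basis z).mem_iff.1 hN
  obtain ⟨C, ⟨hC, hCc⟩, hCsub⟩ := (LocallyConvexSpace.convex_basis (𝕜 := ℝ) z).mem_iff.1 hN'
  exact ⟨closure C, mem_of_superset hC subset_closure, isClosed_closure, hCc.closure,
    (closure_minimal hCsub hN'c).trans hsub⟩

variable [IsTopologicalAddGroup F] [ContinuousSMul ℝ F]

/-- Along two curves `γ₁, γ₂` with limit `y` at time `0` and difference quotients
`t⁻¹ (γ₂ t - γ₁ t)` tending to `k`, the difference quotients of a `C^1`-map `g` tend to `∂_k g y`. -/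
theorem tendsto_differenceQuotient {V : Set F} (hV : IsOpen V) {g : F → G} {g' : F × F → G}
    (hg : ∀ y ∈ V, ∀ k, HasDirDerivAt g (g' (y, k)) y k)
    (hg' : ContinuousOn g' (V ×ˢ Set.univ)) {y k : F} (hy : y ∈ V) {γ₁ γ₂ : ℝ → F}
    (h₁ : Tendsto γ₁ (𝓝[≠] 0) (𝓝 y))
    (h₂ : Tendsto (fun t : ℝ => t⁻¹ • (γ₂ t - γ₁ t)) (𝓝[≠] 0) (𝓝 k)) :
    Tendsto (fun t : ℝ => t⁻¹ • (g (γ₂ t) - g (γ₁ t))) (𝓝[≠] 0) (𝓝 (g' (y, k))) := by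
  set q : ℝ → F := fun t => t⁻¹ • (γ₂ t - γ₁ t) with hq
  intro N hN
  obtain ⟨B, hBn, hBc, hBconv, hBN⟩ := exists_isClosed_convex_subset hN
  have hW : V ×ˢ Set.univ ∩ g' ⁻¹' B ∈ 𝓝 (y, k) := by
    have ho : V ×ˢ (Set.univ : Set F) ∈ 𝓝 (y, k) :=
      (hV.prod isOpen_univ).mem_nhds ⟨hy, trivial⟩
    exact inter_mem ho ((hg'.continuousAt ho).preimage_mem_nhds hBn)
  -- The product with the principal filter of [0, 1] makes this limit uniform along the segment from
  -- `γ₁ t` to `γ₂ t`.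
  have hst : Tendsto (fun p : ℝ × ℝ => (γ₁ p.1 + (p.2 * p.1) • q p.1, q p.1))
      ((𝓝[≠] 0) ×ˢ 𝓟 (Set.Icc (0 : ℝ) 1)) (𝓝 (y, k)) := by
    have hq1 : Tendsto (fun p : ℝ × ℝ => q p.1) ((𝓝[≠] 0) ×ˢ 𝓟 (Set.Icc (0 : ℝ) 1)) (𝓝 k) :=
      h₂.comp tendsto_fst
    have hz : Tendsto (fun p : ℝ × ℝ => p.2 * p.1) ((𝓝[≠] 0) ×ˢ 𝓟 (Set.Icc (0 : ℝ) 1))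
        (𝓝 0) := by
      have h0 : Tendsto (fun p : ℝ × ℝ => p.1) ((𝓝[≠] 0) ×ˢ 𝓟 (Set.Icc (0 : ℝ) 1)) (𝓝 0) :=
        (tendsto_id.mono_left nhdsWithin_le_nhds).comp tendsto_fst
      refine squeeze_zero_norm' ?_ (by simpa using h0.norm)
      rw [eventually_prod_principal_iff]
      refine Eventually.of_forall fun t s hs => ?_
      simp only [Real.norm_eq_abs, abs_mul]
      rw [abs_of_nonneg hs.1]
      exact mul_le_of_le_one_left (abs_nonneg t) hs.2
    have hq2 := hz.smul hq1
    rw [zero_smul] at hq2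
    have := (h₁.comp (tendsto_fst (f := 𝓝[≠] (0 : ℝ)) (g := 𝓟 (Set.Icc (0 : ℝ) 1)))).add hq2
    rw [add_zero] at this
    exact this.prodMk_nhds hq1
  have hev := eventually_prod_principal_iff.1 (hst.eventually hW)
  rw [mem_map]
  filter_upwards [hev, self_mem_nhdsWithin] with t ht ht0
  replace ht0 : t ≠ 0 := ht0
  apply hBN
  -- This curve runs from `t⁻¹ • g (γ₁ t)` to `t⁻¹ • g (γ₂ t)`; the factor `t⁻¹` cancels the speed
  -- `t`, so its velocities are values of `g'` near `(y, k)`.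
  have := sub_mem_of_velocity_mem (c := fun s => t⁻¹ • g (γ₁ t + (s * t) • q t))
    (c' := fun s => g' (γ₁ t + (s * t) • q t, q t)) hBconv hBc ?_ (fun s hs => (ht s hs).2)
  · simpa only [zero_mul, zero_smul, add_zero, one_mul, hq, smul_smul, mul_inv_cancel₀ ht0,
      one_smul, add_sub_cancel, ← smul_sub] using this
  · intro s hs
    have h3 := (hg _ (ht s hs).1.1 (q t)).smul t
    have h4 := h3.clm_comp (t⁻¹ • ContinuousLinearMap.id ℝ G)
    simp only [smul_apply, ContinuousLinearMap.id_apply, smul_smul,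
      inv_mul_cancel₀ ht0, one_smul] at h4
    refine Tendsto.congr (fun r => ?_) h4
    simp only [smul_eq_mul, mul_one, add_mul, add_smul, add_assoc, smul_smul]

end MeanValue

/-! ### C^n-maps via iterated tangent maps, and the chain rule. -/

section TangentCk

/-- `f` is `C^n` on `U` in the recursive sense: `f` is continuous and, if `n > 0`, has all
directional derivatives and its total derivative is `C^{n-1}` on `U × E`. -/
def TangentCkOn {F : Type v} [AddCommGroup F] [Module ℝ F] [TopologicalSpace F] :
    ∀ (_ : ℕ) {E : Type u} [AddCommGroup E] [Module ℝ E] [TopologicalSpace E],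
      (E → F) → Set E → Prop
  | 0, _, _, _, _, f, U => ContinuousOn f U
  | n + 1, _, _, _, _, f, U => ContinuousOn f U ∧
      (∀ x ∈ U, ∀ h, HasDirDerivAt f (dirDeriv f (x, h)) x h) ∧
      TangentCkOn n (dirDeriv f) (U ×ˢ Set.univ)

variable {E : Type u} {E' : Type u} {F : Type v} {G : Type w}
  [AddCommGroup E] [Module ℝ E] [TopologicalSpace E] [IsTopologicalAddGroup E] [ContinuousSMul ℝ E]
  [AddCommGroup E'] [Module ℝ E'] [TopologicalSpace E'] [IsTopologicalAddGroup E']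
  [ContinuousSMul ℝ E']
  [AddCommGroup F] [Module ℝ F] [TopologicalSpace F] [T2Space F]
  [IsTopologicalAddGroup F] [ContinuousSMul ℝ F]
  [AddCommGroup G] [Module ℝ G] [TopologicalSpace G] [T2Space G]
  [IsTopologicalAddGroup G] [ContinuousSMul ℝ G]

theorem TangentCkOn.continuousOn {n : ℕ} {f : E → F} {U : Set E} (H : TangentCkOn n f U) :
    ContinuousOn f U := by
  cases n with
  | zero => exact H
  | succ n => exact H.1

theorem TangentCkOn.mono {n : ℕ} {f : E → F} {U V : Set E} (H : TangentCkOn n f U)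
    (hVU : V ⊆ U) : TangentCkOn n f V := by
  induction n generalizing E with
  | zero => exact ContinuousOn.mono H hVU
  | succ n ih =>
    exact ⟨H.1.mono hVU, fun x hx => H.2.1 x (hVU hx), ih H.2.2 (Set.prod_mono hVU subset_rfl)⟩

theorem TangentCkOn.of_succ {n : ℕ} {f : E → F} {U : Set E} (H : TangentCkOn (n + 1) f U) :
    TangentCkOn n f U := by
  induction n generalizing E with
  | zero => exact H.1
  | succ n ih => exact ⟨H.1, H.2.1, ih H.2.2⟩

theorem TangentCkOn.of_le {m n : ℕ} (hmn : m ≤ n) {f : E → F} {U : Set E}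
    (H : TangentCkOn n f U) : TangentCkOn m f U := by
  induction hmn with
  | refl => exact H
  | step _ ih => exact ih H.of_succ

theorem TangentCkOn.congr {n : ℕ} {f g : E → F} {U : Set E} (hU : IsOpen U)
    (H : TangentCkOn n f U) (hfg : Set.EqOn f g U) : TangentCkOn n g U := by
  induction n generalizing E with
  | zero => exact ContinuousOn.congr H hfg.symm
  | succ n ih =>
    have hd : ∀ x ∈ U, ∀ h, HasDirDerivAt g (dirDeriv f (x, h)) x h := fun x hx h =>
      (H.2.1 x hx h).congr_of_eventuallyEq (hfg.eventuallyEq_of_mem (hU.mem_nhds hx))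
    refine ⟨H.1.congr hfg.symm, fun x hx h => ?_, ih (hU.prod isOpen_univ) H.2.2 ?_⟩
    · rw [(hd x hx h).dirDeriv_eq]
      exact hd x hx h
    · rintro ⟨x, h⟩ hx
      exact (hd x hx.1 h).dirDeriv_eq.symm

/-- Lets a derivative be supplied by a formula `f'`, so that the choice made in `dirDeriv` plays no
role. -/
theorem TangentCkOn.succ {n : ℕ} {f : E → F} {f' : E × E → F} {U : Set E} (hU : IsOpen U)
    (hf : ContinuousOn f U) (hd : ∀ x ∈ U, ∀ h, HasDirDerivAt f (f' (x, h)) x h)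
    (hf' : TangentCkOn n f' (U ×ˢ Set.univ)) : TangentCkOn (n + 1) f U := by
  refine ⟨hf, fun x hx h => ?_, hf'.congr (hU.prod isOpen_univ) ?_⟩
  · rw [(hd x hx h).dirDeriv_eq]
    exact hd x hx h
  · rintro ⟨x, h⟩ hx
    exact (hd x hx.1 h).dirDeriv_eq.symm

theorem TangentCkOn.of_locally {n : ℕ} {f : E → F} {U : Set E}
    (H : ∀ x ∈ U, ∃ V, IsOpen V ∧ x ∈ V ∧ TangentCkOn n f V) : TangentCkOn n f U := by
  induction n generalizing E with
  | zero =>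
    intro x hx
    obtain ⟨V, hV, hxV, hfV⟩ := H x hx
    exact (ContinuousOn.continuousAt hfV (hV.mem_nhds hxV)).continuousWithinAt
  | succ n ih =>
    refine ⟨fun x hx => ?_, fun x hx h => ?_, ih fun p hp => ?_⟩
    · obtain ⟨V, hV, hxV, hfV⟩ := H x hx
      exact (hfV.1.continuousAt (hV.mem_nhds hxV)).continuousWithinAt
    · obtain ⟨V, hV, hxV, hfV⟩ := H x hx
      exact hfV.2.1 x hxV h
    · obtain ⟨V, hV, hxV, hfV⟩ := H p.1 hp.1
      exact ⟨V ×ˢ Set.univ, hV.prod isOpen_univ, ⟨hxV, trivial⟩, hfV.2.2⟩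

theorem TangentCkOn.comp_clm {n : ℕ} {f : E' → F} {U : Set E'} (hU : IsOpen U)
    (H : TangentCkOn n f U) (L : E →L[ℝ] E') : TangentCkOn n (fun x => f (L x)) (L ⁻¹' U) := by
  induction n generalizing E E' with
  | zero => exact ContinuousOn.comp H L.continuous.continuousOn fun x hx => hx
  | succ n ih =>
    exact TangentCkOn.succ (f' := fun p => dirDeriv f (L.prodMap L p)) (hU.preimage L.continuous)
      (H.1.comp L.continuous.continuousOn fun x hx => hx)
      (fun x hx h => (H.2.1 (L x) hx (L h)).comp_clm L)
      (ih (hU.prod isOpen_univ) H.2.2 (L.prodMap L))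

theorem TangentCkOn.clm_comp {n : ℕ} {f : E → F} {U : Set E} (hU : IsOpen U)
    (H : TangentCkOn n f U) (L : F →L[ℝ] G) : TangentCkOn n (fun x => L (f x)) U := by
  induction n generalizing E with
  | zero => exact L.continuous.comp_continuousOn H
  | succ n ih =>
    exact TangentCkOn.succ hU (L.continuous.comp_continuousOn H.1)
      (fun x hx h => (H.2.1 x hx h).clm_comp L) (ih (hU.prod isOpen_univ) H.2.2)

theorem TangentCkOn.prodMk {n : ℕ} {f : E → F} {g : E → G} {U : Set E} (hU : IsOpen U)
    (hf : TangentCkOn n f U) (hg : TangentCkOn n g U) :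
    TangentCkOn n (fun x => (f x, g x)) U := by
  induction n generalizing E with
  | zero => exact ContinuousOn.prodMk hf hg
  | succ n ih =>
    exact TangentCkOn.succ hU (hf.1.prodMk hg.1)
      (fun x hx h => (hf.2.1 x hx h).prodMk (hg.2.1 x hx h)) (ih (hU.prod isOpen_univ) hf.2.2 hg.2.2)

theorem TangentCkOn.add {n : ℕ} {f g : E → F} {U : Set E} (hU : IsOpen U)
    (hf : TangentCkOn n f U) (hg : TangentCkOn n g U) :
    TangentCkOn n (fun x => f x + g x) U :=
  (hf.prodMk hU hg).clm_comp hU (ContinuousLinearMap.fst ℝ F F + ContinuousLinearMap.snd ℝ F F)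

theorem tangentCkOn_clm (n : ℕ) (L : E →L[ℝ] F) (U : Set E) (hU : IsOpen U) :
    TangentCkOn n L U := by
  induction n generalizing E with
  | zero => exact L.continuous.continuousOn
  | succ n ih =>
    exact TangentCkOn.succ hU L.continuous.continuousOn (fun x _ h => L.hasDirDerivAt x h)
      (ih (L.comp (ContinuousLinearMap.snd ℝ E E)) _ (hU.prod isOpen_univ))

theorem tangentCkOn_const (n : ℕ) (c : F) (U : Set E) (hU : IsOpen U) :
    TangentCkOn n (fun _ : E => c) U := by
  cases n with
  | zero => exact continuousOn_const
  | succ n =>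
    refine TangentCkOn.succ hU continuousOn_const (f' := (0 : E × E →L[ℝ] F)) (fun x _ h => ?_)
      (tangentCkOn_clm n _ _ (hU.prod isOpen_univ))
    simp only [HasDirDerivAt, sub_self, smul_zero, zero_apply]
    exact tendsto_const_nhds

theorem TangentCkOn.sum {ι : Type*} (s : Finset ι) {n : ℕ} {f : ι → E → F} {U : Set E}
    (hU : IsOpen U) (hf : ∀ i ∈ s, TangentCkOn n (f i) U) :
    TangentCkOn n (fun x => ∑ i ∈ s, f i x) U := by
  classical
  induction s using Finset.induction_on with
  | empty => simpa using tangentCkOn_const n (0 : F) U hU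
  | insert a s ha ih =>
    simp only [Finset.sum_insert ha]
    exact (hf a (Finset.mem_insert_self a s)).add hU
      (ih fun i hi => hf i (Finset.mem_insert_of_mem hi))

/-- The derivative of a composition, from curves to their images. -/
theorem TangentCkOn.tendsto_curve [LocallyConvexSpace ℝ G] {g : F → G} {V : Set F}
    (hV : IsOpen V) (hg : TangentCkOn 1 g V) {y k : F} (hy : y ∈ V) {γ : ℝ → F}
    (h : Tendsto (fun t : ℝ => t⁻¹ • (γ t - y)) (𝓝[≠] 0) (𝓝 k)) :
    Tendsto (fun t : ℝ => t⁻¹ • (g (γ t) - g y)) (𝓝[≠] 0) (𝓝 (dirDeriv g (y, k))) :=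
  tendsto_differenceQuotient hV hg.2.1 hg.2.2 hy tendsto_const_nhds h

/-- The increment along h + k is the sum of one from x to x + th and one from x + th to x + t(h +
k). The second has a moving base point, which is why `tendsto_differenceQuotient` allows two curves.
-/
theorem TangentCkOn.dirDeriv_add [LocallyConvexSpace ℝ F] {f : E → F} {U : Set E}
    (hU : IsOpen U) (hf : TangentCkOn 1 f U) {x : E} (hx : x ∈ U) (h k : E) :
    dirDeriv f (x, h + k) = dirDeriv f (x, h) + dirDeriv f (x, k) := by
  have h1 := tendsto_differenceQuotient hU hf.2.1 hf.2.2 hx (γ₁ := fun t => x + t • h)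
    (γ₂ := fun t => x + t • (h + k)) (k := k) ((tendsto_line x h).mono_left nhdsWithin_le_nhds) ?_
  · have h2 := Tendsto.add (hf.2.1 x hx h) h1
    refine HasDirDerivAt.dirDeriv_eq (h2.congr fun t => ?_)
    rw [← smul_add]
    congr 1
    abel
  · refine tendsto_const_nhds.congr' ?_
    filter_upwards [self_mem_nhdsWithin] with t ht
    rw [add_sub_add_left_eq_sub, ← smul_sub, smul_smul, inv_mul_cancel₀ (show t ≠ 0 from ht),
      one_smul, add_sub_cancel_left]

theorem TangentCkOn.dirDeriv_smul {f : E → F} {U : Set E}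
    (hf : TangentCkOn 1 f U) {x : E} (hx : x ∈ U) (c : ℝ) (h : E) :
    dirDeriv f (x, c • h) = c • dirDeriv f (x, h) :=
  ((hf.2.1 x hx h).smul c).dirDeriv_eq

/-- The chain rule. -/
theorem TangentCkOn.comp [LocallyConvexSpace ℝ G] {n : ℕ} {f : E → F} {g : F → G} {U : Set E}
    {V : Set F} (hU : IsOpen U) (hV : IsOpen V) (hg : TangentCkOn n g V) (hf : TangentCkOn n f U)
    (hUV : Set.MapsTo f U V) : TangentCkOn n (fun x => g (f x)) U := by
  induction n generalizing E F with
  | zero => exact ContinuousOn.comp hg hf hUV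
  | succ n ih =>
    have hU' : IsOpen (U ×ˢ (Set.univ : Set E)) := hU.prod isOpen_univ
    refine TangentCkOn.succ hU (hg.1.comp hf.1 hUV)
      (f' := fun p => dirDeriv g (f p.1, dirDeriv f p)) (fun x hx h => ?_) ?_
    · exact (hg.of_le (by omega)).tendsto_curve hV (hUV hx) (hf.2.1 x hx h)
    -- The tangent map is again a composition, of `dirDeriv g` with (f, df), so the induction
    -- continues on the products.
    · refine ih hU' (hV.prod isOpen_univ) hg.2.2 (TangentCkOn.prodMk hU' ?_ hf.2.2)
        fun p hp => ⟨hUV hp.1, trivial⟩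
      exact (hf.of_succ.comp_clm hU (ContinuousLinearMap.fst ℝ E E)).mono fun p hp => hp.1

end TangentCk

/-! ### From tangent maps back to iterated directional derivatives. -/

section IteratedDirDeriv

/-- The iterated directional derivatives `(∂_{h_j} ⋯ ∂_{h_1} f) x`. -/
noncomputable def iteratedDirDeriv {F : Type v} [AddCommGroup F] [Module ℝ F] [TopologicalSpace F] :
    ∀ (j : ℕ) {E : Type u} [AddCommGroup E] [Module ℝ E] [TopologicalSpace E],
      (E → F) → E → (Fin j → E) → F
  | 0, _, _, _, _, f, x, _ => f x
  -- The later directions have second component 0: they move the base point and keep the first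
  -- direction `h 0` fixed.
  | j + 1, _, _, _, _, f, x, h => iteratedDirDeriv j (dirDeriv f) (x, h 0) fun i => (h i.succ, 0)

variable {E : Type u} {F : Type v}
  [AddCommGroup E] [Module ℝ E] [TopologicalSpace E] [IsTopologicalAddGroup E] [ContinuousSMul ℝ E]
  [AddCommGroup F] [Module ℝ F] [TopologicalSpace F] [T2Space F]
  [IsTopologicalAddGroup F] [ContinuousSMul ℝ F]

theorem iteratedDirDeriv_succ (j : ℕ) (f : E → F) (x : E) (h : Fin (j + 1) → E) :
    iteratedDirDeriv (j + 1) f x h =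
      iteratedDirDeriv j (dirDeriv f) (x, h 0) fun i => (h i.succ, 0) := rfl

theorem TangentCkOn.continuousOn_iteratedDirDeriv {j n : ℕ} (hj : j ≤ n) {f : E → F} {U : Set E}
    (hf : TangentCkOn n f U) :
    ContinuousOn (fun p : E × (Fin j → E) => iteratedDirDeriv j f p.1 p.2)
      (U ×ˢ Set.univ) := by
  induction j generalizing n E with
  | zero => exact hf.continuousOn.comp continuousOn_fst fun p hp => hp.1
  | succ j ih =>
    obtain ⟨n, rfl⟩ : ∃ m, n = m + 1 := ⟨n - 1, by omega⟩
    have := ih (by omega) hf.2.2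
    refine this.comp (f := fun p : E × (Fin (j + 1) → E) =>
      ((p.1, p.2 0), fun i : Fin j => (p.2 i.succ, (0 : E)))) ?_ fun p hp => ?_
    · fun_prop
    · exact ⟨⟨hp.1, trivial⟩, trivial⟩

theorem TangentCkOn.hasDirDerivAt_iteratedDirDeriv {j n : ℕ} (hj : j + 1 ≤ n) {f : E → F}
    {U : Set E} (hf : TangentCkOn n f U) {x : E} (hx : x ∈ U) (h : Fin j → E) (h' : E) :
    HasDirDerivAt (fun y => iteratedDirDeriv j f y h)
      (iteratedDirDeriv (j + 1) f x (Fin.snoc h h')) x h' := by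
  induction j generalizing n E with
  | zero =>
    obtain ⟨n, rfl⟩ : ∃ m, n = m + 1 := ⟨n - 1, by omega⟩
    exact hf.2.1 x hx h'
  | succ j ih =>
    obtain ⟨n, rfl⟩ : ∃ m, n = m + 1 := ⟨n - 1, by omega⟩
    have h1 := ih (by omega) hf.2.2 (x := (x, h 0)) ⟨hx, trivial⟩ (fun i => (h i.succ, 0)) (h', 0)
    have h2 : iteratedDirDeriv (j + 1 + 1) f x (Fin.snoc h h') =
        iteratedDirDeriv (j + 1) (dirDeriv f) (x, h 0)
          (Fin.snoc (fun i : Fin j => (h i.succ, (0 : E))) (h', 0)) := by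
      rw [iteratedDirDeriv_succ, Fin.snoc_apply_zero]
      congr 1
      funext i
      refine Fin.lastCases ?_ (fun i => ?_) i
      · rw [Fin.snoc_last, Fin.succ_last, Fin.snoc_last]
      · rw [Fin.snoc_castSucc, Fin.succ_castSucc, Fin.snoc_castSucc]
    rw [h2]
    refine Tendsto.congr (fun t => ?_) h1
    simp [iteratedDirDeriv]

theorem isCkOn_of_tangentCkOn {k : ℕ∞} {f : E → F} {U : Set E}
    (hf : ∀ n : ℕ, (n : ℕ∞) ≤ k → TangentCkOn n f U) : IsCkOn k f U :=
  ⟨fun j => iteratedDirDeriv j f, fun _ _ _ => rfl,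
    fun j hj _ hx h h' => (hf (j + 1) hj).hasDirDerivAt_iteratedDirDeriv le_rfl hx h h',
    fun j hj => (hf j hj).continuousOn_iteratedDirDeriv le_rfl⟩

end IteratedDirDeriv

/-! ### Families of multilinear maps and the equivalence of the two notions of C^k. -/

section Multilinear

variable {Y F : Type*} [AddCommGroup Y] [Module ℝ Y] [AddCommGroup F] [Module ℝ F]

/-- `N` is a multilinear map. -/
def IsMultilinear {j : ℕ} (N : (Fin j → Y) → F) : Prop :=
  ∃ M : MultilinearMap ℝ (fun _ : Fin j => Y) F, ∀ y, M y = N y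

theorem isMultilinear_zero (N : (Fin 0 → Y) → F) : IsMultilinear N :=
  ⟨MultilinearMap.constOfIsEmpty ℝ _ (N 0), fun y => by simp [Subsingleton.elim y 0]⟩

theorem IsMultilinear.snoc {j : ℕ} {N : (Fin (j + 1) → Y) → F}
    (h₁ : ∀ z, IsMultilinear fun y : Fin j → Y => N (Fin.snoc y z))
    (h₂ : ∀ y : Fin j → Y, IsLinearMap ℝ fun z => N (Fin.snoc y z)) : IsMultilinear N := by
  classical
  refine ⟨MultilinearMap.mk' N (fun m i x y => ?_) (fun m i c x => ?_), fun y => rfl⟩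
  · rw [← Fin.snoc_init_self m]
    refine Fin.lastCases ?_ (fun i => ?_) i
    · simp only [Fin.update_snoc_last]
      exact (h₂ _).map_add x y
    · simp only [← Fin.snoc_update]
      obtain ⟨M, hM⟩ := h₁ (m (Fin.last j))
      simp only [← hM, M.map_update_add]
  · rw [← Fin.snoc_init_self m]
    refine Fin.lastCases ?_ (fun i => ?_) i
    · simp only [Fin.update_snoc_last]
      exact (h₂ _).map_smul c x
    · simp only [← Fin.snoc_update]
      obtain ⟨M, hM⟩ := h₁ (m (Fin.last j))
      simp only [← hM, M.map_update_smul]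

/-- Sorts the increment by powers of t, ready for division by t. -/
theorem IsMultilinear.apply_add_smul {j : ℕ} {N : (Fin j → Y) → F} (hN : IsMultilinear N)
    (y l : Fin j → Y) (t : ℝ) :
    N (y + t • l) = ∑ S : Finset (Fin j), t ^ S.card • N (S.piecewise l y) := by
  obtain ⟨M, hM⟩ := hN
  rw [add_comm, ← hM, M.map_add_univ]
  refine Finset.sum_congr rfl fun S _ => ?_
  rw [← hM, ← Finset.prod_const, ← M.map_piecewise_smul]
  congr 1
  funext i
  by_cases hi : i ∈ S <;> simp [hi]

end Multilinear

section TangentCkMultilinear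

variable {E : Type u} {Y : Type u} {F : Type v}
  [AddCommGroup E] [Module ℝ E] [TopologicalSpace E] [IsTopologicalAddGroup E] [ContinuousSMul ℝ E]
  [T2Space E]
  [AddCommGroup Y] [Module ℝ Y] [TopologicalSpace Y] [IsTopologicalAddGroup Y] [ContinuousSMul ℝ Y]
  [T2Space Y]
  [AddCommGroup F] [Module ℝ F] [TopologicalSpace F] [T2Space F]
  [IsTopologicalAddGroup F] [ContinuousSMul ℝ F]

/-- In the expansion by subsets `S`, the empty set contributes the increment in x at frozen y, with
derivative `d`. The other terms, divided by t, carry the factor t^(|S| - 1), whose limit 0^(|S| - 1)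
is 1 for singletons and 0 for larger `S`: this is the Leibniz rule. -/
theorem hasDirDerivAt_multilinear {U : Set E} (hU : IsOpen U) {j : ℕ} {D : E → (Fin j → Y) → F}
    (hlin : ∀ x ∈ U, IsMultilinear (D x))
    (hcont : ContinuousOn (fun p : E × (Fin j → Y) => D p.1 p.2) (U ×ˢ Set.univ))
    {x : E} (hx : x ∈ U) (y : Fin j → Y) {h : E} {d : F}
    (hder : HasDirDerivAt (fun z => D z y) d x h) (l : Fin j → Y) :
    HasDirDerivAt (fun p : E × (Fin j → Y) => D p.1 p.2)
      (d + ∑ S ∈ (Finset.univ : Finset (Finset (Fin j))).erase ∅, (0 : ℝ) ^ (S.card - 1) • D x (S.piecewise l y))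
      (x, y) (h, l) := by
  have hline := (tendsto_line x h).mono_left (nhdsWithin_le_nhds (s := {(0 : ℝ)}ᶜ))
  have h1 : ∀ S ∈ (Finset.univ : Finset (Finset (Fin j))).erase ∅,
      Tendsto (fun t : ℝ => t ^ (S.card - 1) • D (x + t • h) (S.piecewise l y)) (𝓝[≠] 0)
        (𝓝 ((0 : ℝ) ^ (S.card - 1) • D x (S.piecewise l y))) := by
    intro S _
    refine Tendsto.smul ?_ ?_
    · exact ((continuous_pow _).tendsto 0).mono_left nhdsWithin_le_nhds
    · have hc := hcont.continuousAt ((hU.prod isOpen_univ).mem_nhds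
        (show (x, S.piecewise l y) ∈ U ×ˢ Set.univ from ⟨hx, trivial⟩))
      exact Tendsto.comp (x := 𝓝[≠] (0 : ℝ)) (f := fun t : ℝ => (x + t • h, S.piecewise l y)) hc
        (hline.prodMk_nhds tendsto_const_nhds)
  refine Tendsto.congr' ?_ (Tendsto.add hder (tendsto_finsetSum _ h1))
  filter_upwards [hline.eventually (hU.mem_nhds hx), self_mem_nhdsWithin] with t ht ht0
  replace ht0 : t ≠ 0 := ht0
  simp only [Prod.fst_add, Prod.snd_add, Prod.smul_fst, Prod.smul_snd]
  rw [(hlin _ ht).apply_add_smul, ← Finset.add_sum_erase _ _ (Finset.mem_univ ∅)]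
  simp only [Finset.card_empty, pow_zero, one_smul, Finset.piecewise_empty]
  rw [add_sub_right_comm, smul_add, Finset.smul_sum]
  congr 1
  refine Finset.sum_congr rfl fun S hS => ?_
  have hS' : S.card ≠ 0 := by
    simpa [Finset.card_eq_zero] using hS
  obtain ⟨m, hm⟩ := Nat.exists_eq_succ_of_ne_zero hS'
  rw [hm, smul_smul, Nat.succ_sub_one, pow_succ', inv_mul_cancel_left₀ ht0]

/-- `Fin.snoc` as a continuous linear map. -/
def snocCLM (j : ℕ) : (Fin j → Y) × Y →L[ℝ] (Fin (j + 1) → Y) where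
  toFun p := Fin.snoc p.1 p.2
  map_add' p q := by
    funext i
    refine Fin.lastCases ?_ (fun i => ?_) i <;> simp
  map_smul' c p := by
    funext i
    refine Fin.lastCases ?_ (fun i => ?_) i <;> simp
  cont := Continuous.finSnoc (A := fun _ => Y) continuous_fst continuous_snd

/-- `(y, l) ↦ S.piecewise l y` as a continuous linear map. -/
def piecewiseCLM {j : ℕ} (S : Finset (Fin j)) : (Fin j → Y) × (Fin j → Y) →L[ℝ] (Fin j → Y) :=
  ContinuousLinearMap.pi fun i =>
    if i ∈ S then (ContinuousLinearMap.proj i).comp (ContinuousLinearMap.snd ℝ _ _)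
    else (ContinuousLinearMap.proj i).comp (ContinuousLinearMap.fst ℝ _ _)

theorem piecewiseCLM_apply {j : ℕ} (S : Finset (Fin j)) (p : (Fin j → Y) × (Fin j → Y)) :
    piecewiseCLM S p = S.piecewise p.2 p.1 := by
  funext i
  by_cases hi : i ∈ S <;> simp [piecewiseCLM, hi]

theorem isMultilinear_of_tendsto {j : ℕ} {N : ℝ → (Fin j → Y) → F} {N' : (Fin j → Y) → F}
    {𝓕 : Filter ℝ} [𝓕.NeBot] (hN : ∀ᶠ t in 𝓕, IsMultilinear (N t))
    (h : ∀ y, Tendsto (fun t => N t y) 𝓕 (𝓝 (N' y))) : IsMultilinear N' := by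
  classical
  refine ⟨MultilinearMap.mk' N' (fun m i x y => ?_) (fun m i c x => ?_), fun y => rfl⟩
  · refine tendsto_nhds_unique (h _) (((h _).add (h _)).congr' ?_)
    filter_upwards [hN] with t ⟨M, hM⟩
    simp only [← hM, M.map_update_add]
  · refine tendsto_nhds_unique (h _) (((h _).const_smul c).congr' ?_)
    filter_upwards [hN] with t ⟨M, hM⟩
    simp only [← hM, M.map_update_smul]

/-- If multilinear maps `D j x`, depending continuously on `x`, are such that the derivative of
`x ↦ D j x (y₁, …, y_j)` in the direction `h` is `D (j + 1) x (y₁, …, y_j, κ (x, h))` with a smooth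
map `κ`, then `D j` is `C^m` whenever `j + m ≤ k`. -/
theorem tangentCkOn_of_multilinear [LocallyConvexSpace ℝ F] {U : Set E} (hU : IsOpen U) {k : ℕ}
    {D : (j : ℕ) → E → (Fin j → Y) → F} {κ : E × E → Y}
    (hκ : ∀ m, TangentCkOn m κ (U ×ˢ Set.univ))
    (hlin : ∀ j ≤ k, ∀ x ∈ U, IsMultilinear (D j x))
    (hder : ∀ j < k, ∀ x ∈ U, ∀ (y : Fin j → Y) (h : E),
      HasDirDerivAt (fun z => D j z y) (D (j + 1) x (Fin.snoc y (κ (x, h)))) x h)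
    (hcont : ∀ j ≤ k, ContinuousOn (fun p : E × (Fin j → Y) => D j p.1 p.2) (U ×ˢ Set.univ))
    (m : ℕ) : ∀ j, j + m ≤ k →
      TangentCkOn m (fun p : E × (Fin j → Y) => D j p.1 p.2) (U ×ˢ Set.univ) := by
  induction m with
  | zero => exact fun j hj => hcont j hj
  | succ m ih =>
    intro j hj
    have hU' : IsOpen (U ×ˢ (Set.univ : Set (Fin j → Y))) := hU.prod isOpen_univ
    have hU'' := hU'.prod (isOpen_univ (X := E × (Fin j → Y)))
    -- The derivative involves only `D (j + 1)` and `D j`, composed with smooth maps; both are C^m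
    -- by the induction hypothesis, which is available for every index j' with j' + m ≤ k.
    refine TangentCkOn.succ hU' (hcont j (by omega)) (f' := fun q =>
      D (j + 1) q.1.1 (Fin.snoc q.1.2 (κ (q.1.1, q.2.1))) +
      ∑ S ∈ (Finset.univ : Finset (Finset (Fin j))).erase ∅, (0 : ℝ) ^ (S.card - 1) • D j q.1.1 (S.piecewise q.2.2 q.1.2))
      (fun p hp hl => ?_) ?_
    · exact hasDirDerivAt_multilinear hU (hlin j (by omega)) (hcont j (by omega)) hp.1 p.2
        (hder j (by omega) p.1 hp.1 p.2 hl.1) hl.2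
    · refine TangentCkOn.add hU'' ?_ (TangentCkOn.sum _ hU'' fun S _ => ?_)
      · have h1 := (ih (j + 1) (by omega)).comp (f := fun q : (E × (Fin j → Y)) × (E × (Fin j → Y)) =>
          (q.1.1, snocCLM j (q.1.2, κ (q.1.1, q.2.1)))) hU'' (hU.prod isOpen_univ)
          (TangentCkOn.prodMk hU'' ?_ (TangentCkOn.clm_comp hU'' (TangentCkOn.prodMk hU'' ?_ ?_) _))
          fun q hq => ⟨hq.1.1, trivial⟩
        · exact h1
        · exact tangentCkOn_clm m ((ContinuousLinearMap.fst ℝ E _).comp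
            (ContinuousLinearMap.fst ℝ (E × (Fin j → Y)) (E × (Fin j → Y)))) _ hU''
        · exact tangentCkOn_clm m ((ContinuousLinearMap.snd ℝ E _).comp
            (ContinuousLinearMap.fst ℝ (E × (Fin j → Y)) (E × (Fin j → Y)))) _ hU''
        · exact ((hκ m).comp_clm (hU.prod isOpen_univ)
            ((ContinuousLinearMap.fst ℝ E (Fin j → Y)).prodMap
              (ContinuousLinearMap.fst ℝ E (Fin j → Y)))).mono fun q hq => ⟨hq.1.1, trivial⟩
      · have h1 := (ih j (by omega)).comp_clm (hU.prod isOpen_univ)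
          (((ContinuousLinearMap.fst ℝ E _).comp
            (ContinuousLinearMap.fst ℝ (E × (Fin j → Y)) (E × (Fin j → Y)))).prod
            ((piecewiseCLM S).comp ((ContinuousLinearMap.snd ℝ E (Fin j → Y)).prodMap
              (ContinuousLinearMap.snd ℝ E (Fin j → Y)))))
        refine ((h1.mono fun q hq => ⟨hq.1.1, trivial⟩).clm_comp hU''
          ((0 : ℝ) ^ (S.card - 1) • ContinuousLinearMap.id ℝ F)).congr hU'' fun q _ => ?_
        simp [piecewiseCLM_apply]

/-- In the old slots, `D (j + 1) x` is a pointwise limit of difference quotients of the multilinear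
maps `D j`; in the new slot it is the differential of a C^1-map, hence linear. -/
theorem IsCkOn.isMultilinear [LocallyConvexSpace ℝ F] {U : Set E} (hU : IsOpen U) {k : ℕ}
    {D : (j : ℕ) → E → (Fin j → E) → F}
    (hder : ∀ j < k, ∀ x ∈ U, ∀ (y : Fin j → E) (h : E),
      HasDirDerivAt (fun z => D j z y) (D (j + 1) x (Fin.snoc y h)) x h)
    (hcont : ∀ j ≤ k, ContinuousOn (fun p : E × (Fin j → E) => D j p.1 p.2) (U ×ˢ Set.univ))
    (j : ℕ) : j ≤ k → ∀ x ∈ U, IsMultilinear (D j x) := by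
  induction j with
  | zero => exact fun _ _ _ => isMultilinear_zero _
  | succ j ih =>
    intro hj x hx
    have hC1 : ∀ y : Fin j → E, TangentCkOn 1 (fun z => D j z y) U := fun y => by
      refine TangentCkOn.succ hU ?_ (f' := fun p => D (j + 1) p.1 (Fin.snoc y p.2))
        (fun z hz h => hder j (by omega) z hz y h) ?_
      · exact (hcont j (by omega)).comp (f := fun z => (z, y)) (by fun_prop)
          fun z hz => ⟨hz, trivial⟩
      · exact (hcont (j + 1) hj).comp (f := fun p : E × E => (p.1, snocCLM j (y, p.2)))
          (s := U ×ˢ Set.univ) (by fun_prop) fun z hz => ⟨hz.1, trivial⟩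
    have heq : ∀ (y : Fin j → E) (h : E),
        D (j + 1) x (Fin.snoc y h) = dirDeriv (fun z => D j z y) (x, h) := fun y h =>
      (hder j (by omega) x hx y h).dirDeriv_eq.symm
    refine IsMultilinear.snoc (fun z => ?_) fun y => ⟨fun h h' => ?_, fun c h => ?_⟩
    · refine isMultilinear_of_tendsto (N := fun t : ℝ => fun y : Fin j → E =>
        t⁻¹ • (D j (x + t • z) y - D j x y)) ?_ fun y => hder j (by omega) x hx y z
      filter_upwards [((tendsto_line x z).eventually (hU.mem_nhds hx)).filter_mono
        nhdsWithin_le_nhds] with t ht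
      obtain ⟨M, hM⟩ := ih (by omega) _ ht
      obtain ⟨M', hM'⟩ := ih (by omega) _ hx
      exact ⟨t⁻¹ • (M - M'), fun y => by simp [hM, hM']⟩
    · rw [heq, heq, heq, (hC1 y).dirDeriv_add hU hx]
    · rw [heq, heq, (hC1 y).dirDeriv_smul hx]

/-- The two notions of `C^k`-maps agree. -/
theorem isCkOn_iff_tangentCkOn [LocallyConvexSpace ℝ F] {k : ℕ∞} {f : E → F} {U : Set E}
    (hU : IsOpen U) : IsCkOn k f U ↔ ∀ n : ℕ, (n : ℕ∞) ≤ k → TangentCkOn n f U := by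
  refine ⟨fun ⟨D, h0, hder, hcont⟩ n hn => ?_, isCkOn_of_tangentCkOn⟩
  have hder' : ∀ j < n, ∀ x ∈ U, ∀ (y : Fin j → E) (h : E),
      HasDirDerivAt (fun z => D j z y) (D (j + 1) x (Fin.snoc y h)) x h := fun j hj =>
    hder j (le_trans (by exact_mod_cast hj) hn)
  have hcont' : ∀ j ≤ n, ContinuousOn (fun p : E × (Fin j → E) => D j p.1 p.2)
      (U ×ˢ Set.univ) := fun j hj => hcont j (le_trans (by exact_mod_cast hj) hn)
  -- In a vector space the new argument is the direction itself, so κ(x, h) = h.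
  have h1 := tangentCkOn_of_multilinear hU (κ := Prod.snd)
    (fun m => tangentCkOn_clm m (ContinuousLinearMap.snd ℝ E E) _ (hU.prod isOpen_univ))
    (IsCkOn.isMultilinear hU hder' hcont') hder' hcont' n 0 (by omega)
  have h2 := h1.comp_clm (hU.prod isOpen_univ) (ContinuousLinearMap.inl ℝ E (Fin 0 → E))
  exact (h2.mono fun x hx => ⟨hx, trivial⟩).congr hU fun x hx => h0 x hx _

end TangentCkMultilinear

/-! ### Automatic continuity on barrelled spaces. -/

section SeparatelyContinuous

variable {Y : Type*} [AddCommGroup Y] [Module ℝ Y] [UniformSpace Y] [IsUniformAddGroup Y]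
  [ContinuousSMul ℝ Y] [BarrelledSpace ℝ Y]
  {V : Type*} [NormedAddCommGroup V] [NormedSpace ℝ V]

/-- Separately continuous multilinear maps on metrizable barrelled spaces are continuous. -/
theorem IsMultilinear.continuous_of_separately [FirstCountableTopology Y] {j : ℕ} {N : (Fin j → Y) → V}
    (hN : IsMultilinear N) (hc : ∀ y i, Continuous fun z => N (Function.update y i z)) :
    Continuous N := by
  classical
  induction j with
  | zero => exact continuous_of_const fun x y => by rw [Subsingleton.elim x y]
  | succ j ih =>
    obtain ⟨M, hM⟩ := id hN
    have hfst : ∀ z, Continuous fun y : Fin j → Y => N (Fin.snoc y z) := fun z => by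
      refine ih ?_ fun y i => ?_
      · refine ⟨MultilinearMap.mk' (fun y : Fin j → Y => N (Fin.snoc y z)) (fun m i x y => ?_)
          (fun m i c x => ?_), fun y => rfl⟩
        · simp only [Fin.snoc_update, ← hM, M.map_update_add]
        · simp only [Fin.snoc_update, ← hM, M.map_update_smul]
      · simp only [Fin.snoc_update]
        exact hc _ _
    have hsnd : ∀ y : Fin j → Y, ∃ L : Y →L[ℝ] V, ∀ z, L z = N (Fin.snoc y z) := fun y => by
      have hu : ∀ z : Y, (Fin.snoc y z : Fin (j + 1) → Y) =
          Function.update (Fin.snoc (α := fun _ => Y) y (0 : Y)) (Fin.last j) z := fun z =>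
        (Fin.update_snoc_last (α := fun _ => Y) (0 : Y) y z).symm
      refine ⟨⟨⟨⟨fun z => N (Fin.snoc y z), fun a b => ?_⟩, fun c a => ?_⟩, ?_⟩, fun z => rfl⟩
      · rw [hu (a + b), hu a, hu b, ← hM, ← hM, ← hM, M.map_update_add]
      · change N (Fin.snoc y (c • a)) = c • N (Fin.snoc y a)
        rw [hu (c • a), hu a, ← hM, ← hM, M.map_update_smul]
      · have := hc (Fin.snoc y 0) (Fin.last j)
        simpa only [Fin.update_snoc_last] using this
    choose L hL using hsnd
    have hjoint : Continuous fun p : (Fin j → Y) × Y => N (Fin.snoc p.1 p.2) := by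
      refine continuous_iff_seqContinuous.2 fun s p hs => ?_
      have hs1 : Tendsto (fun n => (s n).1) atTop (𝓝 p.1) := (continuous_fst.tendsto p).comp hs
      have hs2 : Tendsto (fun n => (s n).2) atTop (𝓝 p.2) := (continuous_snd.tendsto p).comp hs
      have hlim : ∀ z, Tendsto (fun n => L (s n).1 z) atTop (𝓝 (N (Fin.snoc p.1 z))) := fun z => by
        simp only [hL]
        exact ((hfst z).tendsto p.1).comp hs1
      -- Pointwise convergent sequences are pointwise bounded, so the functions of the last variable
      -- are equicontinuous; this absorbs its motion while the other variables converge.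
      have hequi := (norm_withSeminorms ℝ V).banach_steinhaus (𝓕 := fun n => L (s n).1)
        fun _ z => (hlim z).norm.bddAbove_range
      have hat := Metric.equicontinuousAt_iff_right.1 (hequi.equicontinuous p.2)
      refine tendsto_iff_dist_tendsto_zero.2 (Metric.tendsto_atTop.2 fun ε hε => ?_)
      have e1 := hs2.eventually (hat (ε / 2) (by positivity))
      have e2 := (Metric.tendsto_nhds.1 (hlim p.2)) (ε / 2) (by positivity)
      obtain ⟨n0, hn0⟩ := eventually_atTop.1 (e1.and e2)
      refine ⟨n0, fun n hn => ?_⟩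
      obtain ⟨h1, h2⟩ := hn0 n hn
      have h1' := h1 n
      simp only [Function.comp, hL] at h1' h2 ⊢
      rw [Real.dist_0_eq_abs, abs_of_nonneg dist_nonneg]
      calc _ ≤ _ := dist_triangle_left _ _ (N (Fin.snoc (s n).1 p.2))
        _ < ε := by linarith
    have := hjoint.comp (f := fun y : Fin (j + 1) → Y => (Fin.init y, y (Fin.last j))) (by fun_prop)
    simpa only [Function.comp_def, Fin.snoc_init_self] using this

/-- A linear map `T` into a normed space with a norming family of functionals all of whose
compositions with `T` are continuous is continuous. -/
theorem continuous_of_continuous_norming {ι : Type*} (T : Y →ₗ[ℝ] V) (φ : ι → V →L[ℝ] ℂ)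
    (hφ : ∀ i v, ‖φ i v‖ ≤ ‖v‖) (hφ' : ∀ v, ∀ r < ‖v‖, ∃ i, r < ‖φ i v‖)
    (hT : ∀ i, Continuous fun y => φ i (T y)) : Continuous T := by
  set p : Seminorm ℝ Y := (normSeminorm ℝ V).comp T
  -- ‖T y‖ is the supremum of the continuous functions |φ_i(T y)|, hence lower semicontinuous; on a
  -- barrelled space such a seminorm is continuous.
  have hp : Continuous p := by
    refine Seminorm.continuous_of_lowerSemicontinuous p fun y r hr => ?_
    obtain ⟨i, hi⟩ := hφ' (T y) r hr
    filter_upwards [((hT i).norm.tendsto y).eventually (lt_mem_nhds hi)] with z hz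
    exact hz.trans_le (hφ i _)
  refine continuous_of_continuousAt_zero T ?_
  rw [ContinuousAt, map_zero]
  refine tendsto_zero_iff_norm_tendsto_zero.2 ?_
  have := hp.tendsto 0
  rwa [map_zero] at this

end SeparatelyContinuous

/-! ### Smooth maps into the group and orbit maps along them. -/

section SmoothMaps

variable {E : Type u} [AddCommGroup E] [Module ℝ E] [TopologicalSpace E]
  [IsTopologicalAddGroup E] [ContinuousSMul ℝ E] [LocallyConvexSpace ℝ E] [T2Space E]
  {Z Z' : Type u} [AddCommGroup Z] [Module ℝ Z] [TopologicalSpace Z]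
  [IsTopologicalAddGroup Z] [ContinuousSMul ℝ Z]
  [AddCommGroup Z'] [Module ℝ Z'] [TopologicalSpace Z']
  [IsTopologicalAddGroup Z'] [ContinuousSMul ℝ Z']
  {G : Type w} [Group G] [TopologicalSpace G] [ChartedSpace E G]

/-- `f : W → G` is a smooth map from the open subset `W` of a topological vector space to the
manifold `G` modeled on `E`. -/
def IsSmoothInto (E : Type u) [AddCommGroup E] [Module ℝ E] [TopologicalSpace E]
    [ChartedSpace E G] (f : Z → G) (W : Set Z) : Prop :=
  ContinuousOn f W ∧ ∀ e ∈ atlas E G, ∀ m : ℕ,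
    TangentCkOn m (fun z => e (f z)) (W ∩ f ⁻¹' e.source)

theorem IsSmoothInto.isOpen_inter_preimage {f : Z → G} {W : Set Z} (hf : IsSmoothInto E f W)
    (hW : IsOpen W) {O : Set G} (hO : IsOpen O) : IsOpen (W ∩ f ⁻¹' O) :=
  hf.1.isOpen_inter_preimage hW hO

theorem isSmoothInto_const (g : G) (W : Set Z) (hW : IsOpen W) :
    IsSmoothInto E (fun _ : Z => g) W :=
  ⟨continuousOn_const, fun e _ m =>
    tangentCkOn_const m (e g) _ (continuousOn_const.isOpen_inter_preimage hW e.open_source)⟩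

theorem IsSmoothInto.comp_clm {f : Z' → G} {W : Set Z'} (hf : IsSmoothInto E f W)
    (hW : IsOpen W) (L : Z →L[ℝ] Z') : IsSmoothInto E (fun z => f (L z)) (L ⁻¹' W) :=
  ⟨hf.1.comp L.continuous.continuousOn fun _ hz => hz, fun e he m =>
    (hf.2 e he m).comp_clm (hf.isOpen_inter_preimage hW e.open_source) L⟩

theorem IsSmoothInto.mono {f : Z → G} {W W' : Set Z} (hf : IsSmoothInto E f W) (h : W' ⊆ W) :
    IsSmoothInto E f W' :=
  ⟨hf.1.mono h, fun e he m => (hf.2 e he m).mono (Set.inter_subset_inter_left _ h)⟩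

variable [IsTopologicalGroup G]

theorem IsLCLieGroup.isSmoothInto_symm (hG : IsLCLieGroup E G) {e : OpenPartialHomeomorph G E}
    (he : e ∈ atlas E G) : IsSmoothInto E e.symm e.target :=
  ⟨e.continuousOn_symm, fun e' he' m =>
    (isCkOn_iff_tangentCkOn (e.continuousOn_symm.isOpen_inter_preimage e.open_target
      e'.open_source)).1 (hG.smooth_charts e he e' he') m le_top⟩

theorem IsExponential.isSmoothInto {exp : E → G} (hexp : IsExponential exp) :
    IsSmoothInto E exp Set.univ := by
  refine ⟨hexp.smooth.1.continuousOn, fun e he m => ?_⟩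
  have h1 := hexp.smooth.2 (OpenPartialHomeomorph.refl E) (by simp) e he
  simp only [OpenPartialHomeomorph.refl_symm, OpenPartialHomeomorph.refl_apply,
    OpenPartialHomeomorph.refl_target, id_eq, Set.preimage_id] at h1
  exact (isCkOn_iff_tangentCkOn (hexp.smooth.1.continuousOn.isOpen_inter_preimage isOpen_univ
    e.open_source)).1 h1 m le_top

theorem IsLCLieGroup.isSmoothInto_mul (hG : IsLCLieGroup E G) {f₁ f₂ : Z → G} {W : Set Z}
    (hW : IsOpen W) (h₁ : IsSmoothInto E f₁ W) (h₂ : IsSmoothInto E f₂ W) :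
    IsSmoothInto E (fun z => f₁ z * f₂ z) W := by
  refine ⟨h₁.1.mul h₂.1, fun e he m => TangentCkOn.of_locally fun z hz => ?_⟩
  set e₁ := chartAt E (f₁ z)
  set e₂ := chartAt E (f₂ z)
  have he₁ : e₁ ∈ atlas E G := chart_mem_atlas E _
  have he₂ : e₂ ∈ atlas E G := chart_mem_atlas E _
  have hO₁ := h₁.isOpen_inter_preimage hW e₁.open_source
  have hO₂ := h₂.isOpen_inter_preimage hW e₂.open_source
  have hO₃ := (h₁.1.mul h₂.1).isOpen_inter_preimage hW e.open_source
  have hΩ : IsOpen {p : E × E | p.1 ∈ e₁.target ∧ p.2 ∈ e₂.target ∧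
      e₁.symm p.1 * e₂.symm p.2 ∈ e.source} := by
    have hc : ContinuousOn (fun p : E × E => e₁.symm p.1 * e₂.symm p.2)
        (e₁.target ×ˢ e₂.target) :=
      (e₁.continuousOn_symm.comp continuousOn_fst fun p hp => hp.1).mul
        (e₂.continuousOn_symm.comp continuousOn_snd fun p hp => hp.2)
    convert! hc.isOpen_inter_preimage (e₁.open_target.prod e₂.open_target) e.open_source using 1
    ext p
    simp [and_assoc]
  have hmul := (isCkOn_iff_tangentCkOn hΩ).1 (hG.smooth_mul e₁ he₁ e₂ he₂ e he) m le_top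
  have hO := (hO₁.inter hO₂).inter hO₃
  refine ⟨_, hO, ⟨⟨⟨hz.1, mem_chart_source E _⟩, hz.1, mem_chart_source E _⟩, hz⟩, ?_⟩
  refine (hmul.comp hO hΩ (TangentCkOn.prodMk hO ((h₁.2 e₁ he₁ m).mono fun y hy => hy.1.1)
    ((h₂.2 e₂ he₂ m).mono fun y hy => hy.1.2)) fun y hy => ?_).congr hO fun y hy => ?_
  · refine ⟨e₁.map_source hy.1.1.2, e₂.map_source hy.1.2.2, ?_⟩
    simp only [e₁.left_inv hy.1.1.2, e₂.left_inv hy.1.2.2]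
    exact hy.2.2
  · simp only [e₁.left_inv hy.1.1.2, e₂.left_inv hy.1.2.2]

theorem IsLCLieGroup.isSmoothInto_inv (hG : IsLCLieGroup E G) {f : Z → G} {W : Set Z}
    (hW : IsOpen W) (hf : IsSmoothInto E f W) : IsSmoothInto E (fun z => (f z)⁻¹) W := by
  refine ⟨hf.1.inv, fun e he m => TangentCkOn.of_locally fun z hz => ?_⟩
  set e₁ := chartAt E (f z)
  have he₁ : e₁ ∈ atlas E G := chart_mem_atlas E _
  have hO := (hf.isOpen_inter_preimage hW e₁.open_source).inter
    (hf.1.inv.isOpen_inter_preimage hW e.open_source)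
  have hΩ : IsOpen (e₁.target ∩ e₁.symm ⁻¹' ((fun g : G => g⁻¹) ⁻¹' e.source)) :=
    e₁.continuousOn_symm.isOpen_inter_preimage e₁.open_target (e.open_source.preimage continuous_inv)
  have hinv := (isCkOn_iff_tangentCkOn hΩ).1 (hG.smooth_inv.2 e₁ he₁ e he) m le_top
  refine ⟨_, hO, ⟨⟨hz.1, mem_chart_source E _⟩, hz⟩, ?_⟩
  refine (hinv.comp hO hΩ ((hf.2 e₁ he₁ m).mono fun y hy => hy.1) fun y hy => ?_).congr hO
    fun y hy => ?_
  · refine ⟨e₁.map_source hy.1.2, ?_⟩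
    simp only [Set.mem_preimage, e₁.left_inv hy.1.2]
    exact hy.2.2
  · simp only [e₁.left_inv hy.1.2]

variable {H : Type v} [NormedAddCommGroup H] [InnerProductSpace ℂ H] {π : G →* (H ≃ₗᵢ[ℂ] H)}

theorem mem_ckVectors_iff {k : ℕ∞} {v : H} : v ∈ ckVectors E π k ↔
    Continuous (fun g => π g v) ∧ ∀ e ∈ atlas E G, ∀ n : ℕ, (n : ℕ∞) ≤ k →
      TangentCkOn n (fun x => π (e.symm x) v) e.target := by
  simp only [ckVectors, IsCkMap, Set.mem_ofPred_eq, chartedSpaceSelf_atlas, forall_eq,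
    OpenPartialHomeomorph.refl_source, Set.preimage_univ, Set.inter_univ,
    OpenPartialHomeomorph.refl_apply]
  refine and_congr_right fun _ => forall₂_congr fun e _ => ?_
  exact isCkOn_iff_tangentCkOn e.open_target

theorem tangentCkOn_orbit {k : ℕ∞} {v : H} (hv : v ∈ ckVectors E π k) {n : ℕ}
    (hn : (n : ℕ∞) ≤ k) {f : Z → G} {W : Set Z} (hW : IsOpen W) (hf : IsSmoothInto E f W) :
    TangentCkOn n (fun z => π (f z) v) W := by
  refine TangentCkOn.of_locally fun z hz => ?_
  have hO := hf.isOpen_inter_preimage hW (chartAt E (f z)).open_source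
  refine ⟨_, hO, ⟨hz, mem_chart_source E _⟩, ?_⟩
  have h1 := (mem_ckVectors_iff.1 hv).2 _ (chart_mem_atlas E (f z)) n hn
  refine (h1.comp hO (chartAt E (f z)).open_target (hf.2 _ (chart_mem_atlas E (f z)) n)
    fun y hy => (chartAt E (f z)).map_source hy.2).congr hO fun y hy => ?_
  simp only [(chartAt E (f z)).left_inv hy.2]

end SmoothMaps

/-! ### From weak to norm differentiability. -/

section WeakDerivative

variable {H : Type*} [NormedAddCommGroup H] [InnerProductSpace ℂ H]

/-- The bound is a closed condition on w, so it extends by density to w = A. -/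
theorem norm_le_of_forall_inner_le {S : Set H} (hS : Dense S) {A : H} {C : ℝ}
    (hC : 0 ≤ C) (h : ∀ w ∈ S, ‖inner ℂ w A‖ ≤ C * ‖w‖) : ‖A‖ ≤ C := by
  have hcl : IsClosed {w : H | ‖inner ℂ w A‖ ≤ C * ‖w‖} :=
    isClosed_le (by fun_prop) (by fun_prop)
  have hA : ‖inner ℂ A A‖ ≤ C * ‖A‖ := hcl.closure_subset_iff.2 h (hS A)
  have hA' : ‖A‖ * ‖A‖ ≤ C * ‖A‖ := by
    rw [inner_self_eq_norm_sq_to_K] at hA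
    simpa [sq] using hA
  rcases (norm_nonneg A).eq_or_lt with h0 | h0
  · rwa [← h0]
  · exact le_of_mul_le_mul_right hA' h0

/-- The mean value inequality for s ↦ ⟨w, f s - s k(0)⟩ holds with constant ε‖w‖ on an interval
independent of w, so the estimate passes to the norm. -/
theorem hasDerivAt_of_weak {S : Set H} (hS : Dense S) {f k : ℝ → H} (hk : ContinuousAt k 0)
    (h : ∀ᶠ s in 𝓝 (0 : ℝ), ∀ w ∈ S,
      HasDerivAt (fun t => inner ℂ w (f t)) (inner ℂ w (k s)) s) : HasDerivAt f (k 0) 0 := by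
  rw [hasDerivAt_iff_isLittleO]
  refine Asymptotics.isLittleO_iff.2 fun ε hε => ?_
  obtain ⟨δ, hδ, hball⟩ := Metric.eventually_nhds_iff_ball.1
    (h.and (Metric.continuousAt_iff'.1 hk ε hε))
  filter_upwards [Metric.ball_mem_nhds (0 : ℝ) hδ] with t ht
  refine norm_le_of_forall_inner_le hS (by positivity) fun w hw => ?_
  have hd : ∀ s ∈ Metric.ball (0 : ℝ) δ,
      HasDerivWithinAt (fun s : ℝ => (inner ℂ w (f s - s • k 0) : ℂ)) (inner ℂ w (k s - k 0))
        (Metric.ball 0 δ) s := fun s hs => by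
    have h1 := (hball s hs).1 w hw
    have h2 : HasDerivAt (fun s : ℝ => (inner ℂ w (s • k 0) : ℂ)) (inner ℂ w (k 0)) s := by
      simpa [inner_smul_right_eq_smul] using
        (hasDerivAt_id s).smul_const (inner ℂ w (k 0) : ℂ)
    simp only [inner_sub_right]
    exact (h1.sub h2).hasDerivWithinAt
  have := (convex_ball (0 : ℝ) δ).norm_image_sub_le_of_norm_hasDerivWithin_le
    (C := ε * ‖w‖) hd (fun s hs => ?_) (Metric.mem_ball_self hδ) ht
  · simp only [← inner_sub_right, sub_zero, zero_smul] at this ⊢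
    rw [sub_right_comm]
    linarith
  · have h3 := (hball s hs).2
    rw [dist_eq_norm] at h3
    calc _ ≤ ‖w‖ * ‖k s - k 0‖ := norm_inner_le_norm _ _
      _ ≤ ‖w‖ * ε := by gcongr
      _ = _ := mul_comm _ _

theorem HasDirDerivAt.hasDerivAt_line {E V : Type*} [AddCommGroup E] [Module ℝ E]
    [TopologicalSpace E] [NormedAddCommGroup V] [NormedSpace ℝ V] {f : E → V} {l : V}
    {x h : E} {s : ℝ} (H : HasDirDerivAt f l (x + s • h) h) :
    HasDerivAt (fun t : ℝ => f (x + t • h)) l s := by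
  rw [hasDerivAt_iff_tendsto_slope_zero]
  refine Tendsto.congr (fun t => ?_) H
  rw [add_smul, add_assoc]

theorem hasDirDerivAt_of_line {E V : Type*} [AddCommGroup E] [Module ℝ E]
    [TopologicalSpace E] [NormedAddCommGroup V] [NormedSpace ℝ V] {f : E → V} {l : V}
    {x h : E} (H : HasDerivAt (fun t : ℝ => f (x + t • h)) l 0) : HasDirDerivAt f l x h := by
  rw [hasDerivAt_iff_tendsto_slope_zero] at H
  simpa [HasDirDerivAt] using H

/-- The functionals `⟨w, ·⟩ / ‖w‖`, for `w` in a dense set, are norming. -/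
theorem exists_lt_norm_inner {S : Set H} (hS : Dense S) (v : H) (r : ℝ) (hr : r < ‖v‖) :
    ∃ w ∈ S, r < ‖w‖⁻¹ * ‖inner ℂ w v‖ := by
  rcases eq_or_ne v 0 with rfl | hv
  · obtain ⟨w, hw⟩ := hS.nonempty
    exact ⟨w, hw, by simpa using hr⟩
  · have hv' : ‖v‖ ≠ 0 := norm_ne_zero_iff.2 hv
    have hc : ContinuousAt (fun w : H => ‖w‖⁻¹ * ‖inner ℂ w v‖) v := by
      refine ContinuousAt.mul (continuous_norm.continuousAt.inv₀ hv') ?_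
      fun_prop
    have hvv : r < ‖v‖⁻¹ * ‖inner ℂ v v‖ := by
      rw [inner_self_eq_norm_sq_to_K]
      simpa [sq, inv_mul_cancel_left₀ hv'] using hr
    obtain ⟨w, hw, hwS⟩ := mem_closure_iff_nhds.1 (hS v) _ (hc.eventually (lt_mem_nhds hvv))
    exact ⟨w, hwS, hw⟩

end WeakDerivative

/-! ### Generators of one-parameter groups: skew symmetry, linearity, continuity. -/

section Generators

variable {E : Type u} [AddCommGroup E] [Module ℝ E] [UniformSpace E] [IsUniformAddGroup E]
  [ContinuousSMul ℝ E] [LocallyConvexSpace ℝ E] [T2Space E]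
  {G : Type w} [Group G] [TopologicalSpace G] [IsTopologicalGroup G] [ChartedSpace E G]
  {exp : E → G}
  {H : Type v} [NormedAddCommGroup H] [InnerProductSpace ℂ H] {π : G →* (H ≃ₗᵢ[ℂ] H)}

theorem IsExponential.map_zero (hexp : IsExponential exp) : exp 0 = 1 := by
  have := hexp.add_smul 0 0 0
  simpa using this

theorem rep_mul_apply (π : G →* (H ≃ₗᵢ[ℂ] H)) (a b : G) (v : H) : π (a * b) v = π a (π b v) := by
  rw [map_mul]
  rfl

theorem rep_one_apply (π : G →* (H ≃ₗᵢ[ℂ] H)) (v : H) : π 1 v = v := by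
  rw [map_one]
  rfl

theorem rep_smul (π : G →* (H ≃ₗᵢ[ℂ] H)) (g : G) (t : ℝ) (v : H) : π g (t • v) = t • π g v :=
  ((π g).toLinearEquiv.toLinearMap.restrictScalars ℝ).map_smul t v

/-- The orbit maps of a unitary representation are continuous if those of the elements of a dense
set are. -/
theorem continuous_rep {S : Set H} (hS : Dense S) (h : ∀ w ∈ S, Continuous fun g => π g w) :
    Continuous fun p : G × H => π p.1 p.2 := by
  have horb : ∀ v, Continuous fun g => π g v := fun v => by
    refine continuous_of_uniform_approx_of_continuous fun u hu => ?_
    obtain ⟨ε, hε, hεu⟩ := Metric.mem_uniformity_dist.1 hu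
    obtain ⟨w, hw, hwv⟩ := Metric.mem_closure_iff.1 (hS v) ε hε
    exact ⟨fun g => π g w, h w hw, fun g => hεu (by rwa [(π g).dist_map])⟩
  refine continuous_iff_continuousAt.2 fun p => ?_
  refine tendsto_iff_dist_tendsto_zero.2 ?_
  have h1 : Tendsto (fun q : G × H => dist q.2 p.2 + dist (π q.1 p.2) (π p.1 p.2)) (𝓝 p) (𝓝 0) := by
    have : Continuous (fun q : G × H => dist q.2 p.2 + dist (π q.1 p.2) (π p.1 p.2)) :=
      (continuous_snd.dist continuous_const).add
        (((horb p.2).comp continuous_fst).dist continuous_const)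
    simpa using this.tendsto p
  refine squeeze_zero (fun _ => dist_nonneg) (fun q => ?_) h1
  calc dist (π q.1 q.2) (π p.1 p.2) ≤ dist (π q.1 q.2) (π q.1 p.2) + dist (π q.1 p.2) (π p.1 p.2) :=
        dist_triangle _ _ _
    _ = _ := by rw [(π q.1).dist_map]

/-- `C^1`-vectors can be differentiated along all curves in `G` starting in `1`. -/
theorem tendsto_rep_curve {w : H} (hw : w ∈ ckVectors E π 1) {η : ℝ → G} {y : E}
    (hη : Tendsto η (𝓝[≠] 0) (𝓝 1))
    (hy : Tendsto (fun t : ℝ => t⁻¹ • (chartAt E (1 : G) (η t) - chartAt E (1 : G) 1))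
      (𝓝[≠] 0) (𝓝 y)) :
    Tendsto (fun t : ℝ => t⁻¹ • (π (η t) w - w)) (𝓝[≠] 0)
      (𝓝 (dirDeriv (fun x => π ((chartAt E (1 : G)).symm x) w) (chartAt E (1 : G) 1, y))) := by
  set φ := chartAt E (1 : G)
  have h1 : (1 : G) ∈ φ.source := mem_chart_source E 1
  have hC := (mem_ckVectors_iff.1 hw).2 φ (chart_mem_atlas E 1) 1 le_rfl
  refine (hC.tendsto_curve φ.open_target (φ.map_source h1) (γ := fun t => φ (η t)) hy).congr' ?_
  filter_upwards [hη.eventually (φ.open_source.mem_nhds h1)] with t ht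
  rw [φ.left_inv ht, φ.left_inv h1, rep_one_apply]

theorem IsExponential.tendsto_nhds_one (hexp : IsExponential exp) (y : E) :
    Tendsto (fun t : ℝ => exp (t • y)) (𝓝[≠] 0) (𝓝 1) := by
  have hc : Continuous fun t : ℝ => exp (t • y) := hexp.smooth.1.comp (by fun_prop)
  refine (hc.tendsto' 0 1 ?_).mono_left nhdsWithin_le_nhds
  rw [zero_smul, hexp.map_zero]

theorem IsExponential.hasDerivAt_iff (hexp : IsExponential exp) {y : E} {u l : H} :
    HasDerivAt (fun t : ℝ => π (exp (t • y)) u) l 0 ↔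
      Tendsto (fun t : ℝ => t⁻¹ • (π (exp (t • y)) u - u)) (𝓝[≠] 0) (𝓝 l) := by
  rw [hasDerivAt_iff_tendsto_slope_zero]
  simp only [zero_add, zero_smul, hexp.map_zero, rep_one_apply]

theorem IsExponential.hasDerivAt_of_mem_ckVectors (hexp : IsExponential exp) {w : H}
    (hw : w ∈ ckVectors E π 1) (y : E) :
    HasDerivAt (fun t : ℝ => π (exp (t • y)) w)
      (dirDeriv (fun x => π ((chartAt E (1 : G)).symm x) w) (chartAt E (1 : G) 1, y)) 0 :=
  hexp.hasDerivAt_iff.2 (tendsto_rep_curve hw (hexp.tendsto_nhds_one y) (hexp.velocity y))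

theorem hasDerivAt_generator {y : E} {u : H} (hu : u ∈ generatorDomain π exp y) :
    HasDerivAt (fun t : ℝ => π (exp (t • y)) u) (generator π exp y u) 0 :=
  DifferentiableAt.hasDerivAt hu

theorem IsExponential.mem_generatorDomain (hexp : IsExponential exp) {w : H}
    (hw : w ∈ ckVectors E π 1) (y : E) : w ∈ generatorDomain π exp y :=
  (hexp.hasDerivAt_of_mem_ckVectors hw y).differentiableAt

theorem IsExponential.generator_eq_dirDeriv (hexp : IsExponential exp) {w : H}
    (hw : w ∈ ckVectors E π 1) (y : E) : generator π exp y w =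
      dirDeriv (fun x => π ((chartAt E (1 : G)).symm x) w) (chartAt E (1 : G) 1, y) :=
  (hexp.hasDerivAt_of_mem_ckVectors hw y).deriv

theorem IsExponential.generator_add_left (hexp : IsExponential exp) {w : H}
    (hw : w ∈ ckVectors E π 1) (y z : E) :
    generator π exp (y + z) w = generator π exp y w + generator π exp z w := by
  simp only [hexp.generator_eq_dirDeriv hw]
  exact ((mem_ckVectors_iff.1 hw).2 _ (chart_mem_atlas E 1) 1 le_rfl).dirDeriv_add
    (chartAt E (1 : G)).open_target ((chartAt E (1 : G)).map_source (mem_chart_source E 1)) y z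

theorem IsExponential.generator_smul_left (hexp : IsExponential exp) {w : H}
    (hw : w ∈ ckVectors E π 1) (c : ℝ) (y : E) :
    generator π exp (c • y) w = c • generator π exp y w := by
  simp only [hexp.generator_eq_dirDeriv hw]
  exact ((mem_ckVectors_iff.1 hw).2 _ (chart_mem_atlas E 1) 1 le_rfl).dirDeriv_smul
    ((chartAt E (1 : G)).map_source (mem_chart_source E 1)) c y

theorem IsExponential.continuous_generator_left (hexp : IsExponential exp) {w : H}
    (hw : w ∈ ckVectors E π 1) : Continuous fun y => generator π exp y w := by
  simp only [hexp.generator_eq_dirDeriv hw]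
  have hC := ((mem_ckVectors_iff.1 hw).2 _ (chart_mem_atlas E (1 : G)) 1 le_rfl).2.2
  exact ContinuousOn.comp_continuous (f := fun y => (chartAt E (1 : G) 1, y)) hC (by fun_prop)
    fun y => ⟨(chartAt E (1 : G)).map_source (mem_chart_source E 1), trivial⟩

theorem generator_add {y : E} {u v : H} (hu : u ∈ generatorDomain π exp y)
    (hv : v ∈ generatorDomain π exp y) :
    generator π exp y (u + v) = generator π exp y u + generator π exp y v := by
  have := (hasDerivAt_generator hu).add (hasDerivAt_generator hv)
  refine (this.congr_of_eventuallyEq (Eventually.of_forall fun t => ?_)).deriv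
  simp

theorem generator_smul {y : E} {u : H} (hu : u ∈ generatorDomain π exp y) (c : ℝ) :
    generator π exp y (c • u) = c • generator π exp y u := by
  have := (hasDerivAt_generator hu).const_smul c
  refine (this.congr_of_eventuallyEq (Eventually.of_forall fun t => ?_)).deriv
  simp [rep_smul]

/-- Weak differentiability of orbit maps along curves starting in `1`. -/
theorem IsExponential.tendsto_inner_curve (hexp : IsExponential exp)
    (hcont : Continuous fun p : G × H => π p.1 p.2) {w : H} (hw : w ∈ ckVectors E π 1) (u : H)
    {η : ℝ → G} {y : E} (hη : Tendsto η (𝓝[≠] 0) (𝓝 1))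
    (hy : Tendsto (fun t : ℝ => t⁻¹ • (chartAt E (1 : G) (η t) - chartAt E (1 : G) 1))
      (𝓝[≠] 0) (𝓝 y)) :
    Tendsto (fun t : ℝ => t⁻¹ • (inner ℂ w (π (η t) u) - inner ℂ w u : ℂ)) (𝓝[≠] 0)
      (𝓝 (-inner ℂ (generator π exp y w) u)) := by
  have h1 := tendsto_rep_curve hw hη hy
  rw [← hexp.generator_eq_dirDeriv hw] at h1
  have h2 : Tendsto (fun t => π (η t) u) (𝓝[≠] 0) (𝓝 u) := by
    have := (hcont.tendsto (1, u)).comp (hη.prodMk_nhds (tendsto_const_nhds (x := u)))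
    simpa [rep_one_apply, Function.comp_def] using this
  refine (h1.inner h2 (𝕜 := ℂ)).neg.congr fun t => ?_
  rw [inner_smul_left_eq_smul, ← smul_neg, inner_sub_left, (π (η t)).inner_map_map, neg_sub]

theorem IsExponential.inner_generator (hexp : IsExponential exp)
    (hcont : Continuous fun p : G × H => π p.1 p.2) {w : H} (hw : w ∈ ckVectors E π 1) {u : H}
    {y : E} (hu : u ∈ generatorDomain π exp y) :
    inner ℂ w (generator π exp y u) = -inner ℂ (generator π exp y w) u := by
  refine tendsto_nhds_unique ?_
    (hexp.tendsto_inner_curve hcont hw u (hexp.tendsto_nhds_one y) (hexp.velocity y))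
  have h1 := hexp.hasDerivAt_iff.1 (hasDerivAt_generator hu)
  refine ((tendsto_const_nhds (x := w)).inner h1 (𝕜 := ℂ)).congr fun t => ?_
  rw [inner_smul_right_eq_smul, inner_sub_right]

/-- Against w in the dense set H^1, skew symmetry moves the generator to w, where linearity in y is
that of a differential. -/
theorem IsExponential.isLinearMap_generator (hexp : IsExponential exp)
    (hπ : Dense (ckVectors E π 1)) (hcont : Continuous fun p : G × H => π p.1 p.2) {u : H}
    (hu : ∀ y, u ∈ generatorDomain π exp y) : IsLinearMap ℝ fun y => generator π exp y u where
  map_add y z := by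
    refine hπ.eq_of_inner_right ℂ fun w hw => ?_
    rw [inner_add_right, hexp.inner_generator hcont hw (hu _), hexp.inner_generator hcont hw (hu _),
      hexp.inner_generator hcont hw (hu _), hexp.generator_add_left hw, inner_add_left, neg_add]
  map_smul c y := by
    refine hπ.eq_of_inner_right ℂ fun w hw => ?_
    rw [inner_smul_right_eq_smul, hexp.inner_generator hcont hw (hu _),
      hexp.inner_generator hcont hw (hu _), hexp.generator_smul_left hw, inner_smul_left_eq_smul,
      smul_neg]

/-- The normalized functionals ⟨w, ·⟩/‖w‖ with w in `S` are norming. -/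
theorem continuous_of_continuous_inner [BarrelledSpace ℝ E] {S : Set H} (hS : Dense S)
    (T : E →ₗ[ℝ] H) (hT : ∀ w ∈ S, Continuous fun y => inner ℂ w (T y)) : Continuous T := by
  refine continuous_of_continuous_norming (ι := S) T
    (fun w => ((‖w.1‖⁻¹ : ℝ)) • (innerSL ℂ w.1).restrictScalars ℝ) (fun w v => ?_) (fun v r hr => ?_)
    fun w => ?_
  · simp only [smul_apply, ContinuousLinearMap.coe_restrictScalars', innerSL_apply_apply, norm_smul,
      norm_inv, norm_norm]
    calc _ ≤ ‖w.1‖⁻¹ * (‖w.1‖ * ‖v‖) := by gcongr; exact norm_inner_le_norm _ _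
      _ ≤ ‖v‖ := by
        rw [← mul_assoc]
        exact mul_le_of_le_one_left (norm_nonneg v) (inv_mul_le_one)
  · obtain ⟨w, hw, hwr⟩ := exists_lt_norm_inner hS v r hr
    exact ⟨⟨w, hw⟩, by simpa [norm_smul] using hwr⟩
  · exact (hT w.1 w.2).const_smul (‖w.1‖⁻¹ : ℝ)

end Generators

/-! ### Differentiation of orbit maps and the two inclusions. -/

section OrbitMaps

variable {E : Type u} [AddCommGroup E] [Module ℝ E] [UniformSpace E] [IsUniformAddGroup E]
  [ContinuousSMul ℝ E] [LocallyConvexSpace ℝ E] [T2Space E]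
  {G : Type w} [Group G] [TopologicalSpace G] [IsTopologicalGroup G] [ChartedSpace E G]
  {exp : E → G}
  {H : Type v} [NormedAddCommGroup H] [InnerProductSpace ℂ H] {π : G →* (H ≃ₗᵢ[ℂ] H)}

/-- The left logarithmic derivative of the inverse of the chart `e`: the velocity at `t = 0`
of the curve `t ↦ (e⁻¹ x)⁻¹ e⁻¹ (x + t h)` starting in `1`. -/
noncomputable def leftLogDeriv (e : OpenPartialHomeomorph G E) (p : E × E) : E :=
  dirDeriv (fun q : E × E => chartAt E (1 : G) ((e.symm q.1)⁻¹ * e.symm q.2)) ((p.1, p.1), (0, p.2))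

theorem IsLCLieGroup.isSmoothInto_inv_mul (hG : IsLCLieGroup E G) {e : OpenPartialHomeomorph G E}
    (he : e ∈ atlas E G) :
    IsSmoothInto E (fun q : E × E => (e.symm q.1)⁻¹ * e.symm q.2) (e.target ×ˢ e.target) := by
  have hO := e.open_target.prod e.open_target
  have hs := hG.isSmoothInto_symm he
  exact hG.isSmoothInto_mul hO
    (hG.isSmoothInto_inv hO ((hs.comp_clm e.open_target (ContinuousLinearMap.fst ℝ E E)).mono
      fun q hq => hq.1))
    ((hs.comp_clm e.open_target (ContinuousLinearMap.snd ℝ E E)).mono fun q hq => hq.2)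

theorem IsLCLieGroup.diagonal_mem {e : OpenPartialHomeomorph G E} {x : E} (hx : x ∈ e.target) :
    (x, x) ∈ (e.target ×ˢ e.target) ∩ (fun q : E × E => (e.symm q.1)⁻¹ * e.symm q.2) ⁻¹'
      (chartAt E (1 : G)).source := by
  refine ⟨⟨hx, hx⟩, ?_⟩
  simp

/-- The map (x, z) ↦ σ(x)⁻¹σ(z) is smooth near the diagonal, and κ is its tangent map restricted
along a continuous linear map. -/
theorem IsLCLieGroup.tangentCkOn_leftLogDeriv (hG : IsLCLieGroup E G)
    {e : OpenPartialHomeomorph G E} (he : e ∈ atlas E G) (m : ℕ) :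
    TangentCkOn m (leftLogDeriv e) (e.target ×ˢ Set.univ) := by
  have hs := hG.isSmoothInto_inv_mul he
  have hO := hs.isOpen_inter_preimage (e.open_target.prod e.open_target)
    (chartAt E (1 : G)).open_source
  have h1 := (hs.2 _ (chart_mem_atlas E (1 : G)) (m + 1)).2.2
  have h2 := h1.comp_clm (hO.prod isOpen_univ)
    (((ContinuousLinearMap.fst ℝ E E).prod (ContinuousLinearMap.fst ℝ E E)).prod
      ((0 : E × E →L[ℝ] E).prod (ContinuousLinearMap.snd ℝ E E)))
  exact h2.mono fun p hp => ⟨IsLCLieGroup.diagonal_mem hp.1, trivial⟩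

theorem IsLCLieGroup.hasDirDerivAt_leftLogDeriv (hG : IsLCLieGroup E G)
    {e : OpenPartialHomeomorph G E} (he : e ∈ atlas E G) {x : E} (hx : x ∈ e.target) (h : E) :
    Tendsto (fun t : ℝ => t⁻¹ • (chartAt E (1 : G) ((e.symm x)⁻¹ * e.symm (x + t • h)) -
      chartAt E (1 : G) 1)) (𝓝[≠] 0) (𝓝 (leftLogDeriv e (x, h))) := by
  have h1 := ((hG.isSmoothInto_inv_mul he).2 _ (chart_mem_atlas E (1 : G)) 1).2.1 (x, x)
    (IsLCLieGroup.diagonal_mem hx) (0, h)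
  refine Tendsto.congr (fun t => ?_) h1
  simp

/-- The orbit map of π(g)v is that of v after right translation by g, a smooth map. -/
theorem IsLCLieGroup.rep_mem_ckVectors (hG : IsLCLieGroup E G) {k : ℕ∞} {v : H}
    (hv : v ∈ ckVectors E π k) (g : G) : π g v ∈ ckVectors E π k := by
  refine mem_ckVectors_iff.2 ⟨?_, fun e he n hn => ?_⟩
  · have := (mem_ckVectors_iff.1 hv).1.comp (continuous_mul_const g)
    simpa only [Function.comp_def, rep_mul_apply] using this
  · have := tangentCkOn_orbit hv hn e.open_target (hG.isSmoothInto_mul e.open_target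
      (hG.isSmoothInto_symm he) (isSmoothInto_const g _ e.open_target))
    simpa only [rep_mul_apply] using this

/-- The orbit map of a vector `u` in the domains of all generators has directional derivatives. -/
theorem IsLCLieGroup.hasDirDerivAt_orbit (hG : IsLCLieGroup E G) (hexp : IsExponential exp)
    [BarrelledSpace ℝ E] (hπ : Dense (ckVectors E π 1))
    (hcont : Continuous fun p : G × H => π p.1 p.2)
    {u : H} (hu : ∀ y, u ∈ generatorDomain π exp y) {e : OpenPartialHomeomorph G E}
    (he : e ∈ atlas E G) {x : E} (hx : x ∈ e.target) (h : E) :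
    HasDirDerivAt (fun z => π (e.symm z) u)
      (π (e.symm x) (generator π exp (leftLogDeriv e (x, h)) u)) x h := by
  have hgen : Continuous fun y => generator π exp y u :=
    continuous_of_continuous_inner hπ ((hexp.isLinearMap_generator hπ hcont hu).mk' _)
      fun w hw => by
        simp only [IsLinearMap.mk'_apply, hexp.inner_generator hcont hw (hu _)]
        exact ((hexp.continuous_generator_left hw).inner continuous_const).neg
  have hweak : ∀ x ∈ e.target, ∀ w ∈ ckVectors E π 1,
      HasDirDerivAt (fun z => (inner ℂ w (π (e.symm z) u) : ℂ))
        (inner ℂ w (π (e.symm x) (generator π exp (leftLogDeriv e (x, h)) u))) x h := by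
    intro x hx w hw
    -- Left translation to a curve starting in 1: σ(x) is moved to the other side as π(σ(x))⁻¹w,
    -- which is again in H^1.
    have hw' := hG.rep_mem_ckVectors hw (e.symm x)⁻¹
    have hmove : ∀ v : H, (inner ℂ (π (e.symm x)⁻¹ w) v : ℂ) = inner ℂ w (π (e.symm x) v) :=
      fun v => by
        rw [← (π (e.symm x)).inner_map_map, ← rep_mul_apply, mul_inv_cancel, rep_one_apply]
    have hη : Tendsto (fun t : ℝ => (e.symm x)⁻¹ * e.symm (x + t • h)) (𝓝[≠] 0) (𝓝 1) := by
      have h1 := (e.continuousAt_symm hx).tendsto.comp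
        ((tendsto_line x h).mono_left (nhdsWithin_le_nhds (s := {(0 : ℝ)}ᶜ)))
      simpa using h1.const_mul (e.symm x)⁻¹
    have h2 := hexp.tendsto_inner_curve hcont hw' u hη (hG.hasDirDerivAt_leftLogDeriv he hx h)
    rw [← hexp.inner_generator hcont hw' (hu _),
      hmove (generator π exp _ u)] at h2
    refine Tendsto.congr (fun t => ?_) h2
    rw [hmove, hmove, ← rep_mul_apply, mul_inv_cancel_left]
  have hline := tendsto_line x h
  have hκ := ((hG.tangentCkOn_leftLogDeriv he 0).continuousOn.continuousAt
    ((e.open_target.prod isOpen_univ).mem_nhds (show (x, h) ∈ e.target ×ˢ Set.univ from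
      ⟨hx, trivial⟩)))
  -- The weak derivative exists along the whole line near x, and its value is norm continuous at x
  -- by `hgen` and the continuity of κ.
  have hd := hasDerivAt_of_weak hπ (f := fun t : ℝ => π (e.symm (x + t • h)) u)
    (k := fun s : ℝ => π (e.symm (x + s • h))
      (generator π exp (leftLogDeriv e (x + s • h, h)) u)) ?_ ?_
  · refine hasDirDerivAt_of_line ?_
    simpa using hd
  · have h1 : Tendsto (fun s : ℝ => e.symm (x + s • h)) (𝓝 0) (𝓝 (e.symm x)) :=
      (e.continuousAt_symm hx).tendsto.comp hline
    have h2 : Tendsto (fun s : ℝ => generator π exp (leftLogDeriv e (x + s • h, h)) u) (𝓝 0)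
        (𝓝 (generator π exp (leftLogDeriv e (x, h)) u)) :=
      (hgen.tendsto _).comp (hκ.tendsto.comp (hline.prodMk_nhds (tendsto_const_nhds (x := h))))
    have h3 := (hcont.tendsto _).comp (h1.prodMk_nhds h2)
    rw [ContinuousAt, zero_smul, add_zero]
    exact h3
  · filter_upwards [hline.eventually (e.open_target.mem_nhds hx)] with s hs w hw
    exact (hweak _ hs w hw).hasDerivAt_line

/-- `dπ(y_j) ⋯ dπ(y_1) v`. -/
noncomputable def iteratedGenerator (π : G →* (H ≃ₗᵢ[ℂ] H)) (exp : E → G) (v : H) :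
    (j : ℕ) → (Fin j → E) → H
  | 0, _ => v
  | j + 1, y => generator π exp (y (Fin.last j)) (iteratedGenerator π exp v j (Fin.init y))

theorem iteratedGenerator_snoc (v : H) {j : ℕ} (y : Fin j → E) (z : E) :
    iteratedGenerator π exp v (j + 1) (Fin.snoc y z) =
      generator π exp z (iteratedGenerator π exp v j y) := by
  simp [iteratedGenerator]

theorem iteratedGenerator_mem {v : H} (j : ℕ) : ∀ {m : ℕ},
    v ∈ generatorDomains π exp (j + m) → ∀ y : Fin j → E,
      iteratedGenerator π exp v j y ∈ generatorDomains π exp m := by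
  induction j with
  | zero => exact fun hv _ => by rwa [zero_add] at hv
  | succ j ih =>
    intro m hv y
    have := ih (m := m + 1) (by rwa [add_right_comm, add_assoc] at hv) (Fin.init y)
    exact this.2 _

theorem iteratedGenerator_mem_generatorDomain {v : H} {n j : ℕ} (hj : j < n)
    (hv : v ∈ generatorDomains π exp n) (y : Fin j → E) (z : E) :
    iteratedGenerator π exp v j y ∈ generatorDomain π exp z := by
  obtain ⟨m, rfl⟩ : ∃ m, n = j + (m + 1) := ⟨n - j - 1, by omega⟩
  exact Set.mem_iInter.1 (iteratedGenerator_mem j hv y).1 z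

/-- The last slot is linear by weak testing against H^1, the earlier ones because each operator
dπ(z) is linear on its domain. -/
theorem IsExponential.isMultilinear_iteratedGenerator (hexp : IsExponential exp)
    (hπ : Dense (ckVectors E π 1)) (hcont : Continuous fun p : G × H => π p.1 p.2) {v : H} {n : ℕ}
    (hv : v ∈ generatorDomains π exp n) (j : ℕ) (hj : j ≤ n) :
    IsMultilinear (iteratedGenerator π exp v j) := by
  classical
  induction j with
  | zero => exact isMultilinear_zero _
  | succ j ih =>
    have hmem := iteratedGenerator_mem_generatorDomain (j := j) (by omega) hv
    refine IsMultilinear.snoc (fun z => ?_) fun y => ?_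
    · obtain ⟨M, hM⟩ := ih (by omega)
      simp only [iteratedGenerator_snoc, ← hM] at hmem ⊢
      refine ⟨MultilinearMap.mk' (fun y => generator π exp z (M y)) (fun m i a b => ?_)
        (fun m i c a => ?_), fun y => rfl⟩
      · rw [M.map_update_add, generator_add (hmem _ z) (hmem _ z)]
      · rw [M.map_update_smul, generator_smul (hmem _ z)]
    · simp only [iteratedGenerator_snoc]
      exact hexp.isLinearMap_generator hπ hcont (hmem y)

/-- Weak continuity suffices. Moving the outermost generator to w leaves, for the last slot, the
continuous map z ↦ dπ(z)w, and for another slot the case of j factors paired with a fixed vector. -/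
theorem IsExponential.continuous_iteratedGenerator_update [BarrelledSpace ℝ E]
    (hexp : IsExponential exp) (hπ : Dense (ckVectors E π 1))
    (hcont : Continuous fun p : G × H => π p.1 p.2) {v : H} {n : ℕ}
    (hv : v ∈ generatorDomains π exp n) (j : ℕ) (hj : j ≤ n) (y : Fin j → E) (i : Fin j) :
    Continuous fun z => iteratedGenerator π exp v j (Function.update y i z) := by
  induction j with
  | zero => exact i.elim0
  | succ j ih =>
    have hmem := iteratedGenerator_mem_generatorDomain (j := j) (by omega) hv
    obtain ⟨M, hM⟩ := hexp.isMultilinear_iteratedGenerator hπ hcont hv (j + 1) hj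
    have := continuous_of_continuous_inner hπ (M.toLinearMap y i) fun w hw => ?_
    · exact this.congr fun z => by rw [MultilinearMap.toLinearMap_apply, hM]
    simp only [MultilinearMap.toLinearMap_apply, hM, iteratedGenerator,
      hexp.inner_generator hcont hw (hmem _ _)]
    refine Continuous.neg ?_
    induction i using Fin.lastCases with
    | last =>
      simp only [Fin.init_update_last, Function.update_self]
      exact (hexp.continuous_generator_left hw).inner continuous_const
    | cast i =>
      simp only [Fin.init_update_castSucc, Function.update_of_ne (Fin.castSucc_ne_last i).symm]
      exact continuous_const.inner (ih (by omega) _ _)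

theorem IsLCLieGroup.generatorDomains_subset_ckVectors (hG : IsLCLieGroup E G)
    (hexp : IsExponential exp) [BarrelledSpace ℝ E] [FirstCountableTopology E]
    (hπ : Dense (ckVectors E π 1)) (hcont : Continuous fun p : G × H => π p.1 p.2) (n : ℕ) :
    generatorDomains π exp n ⊆ ckVectors E π n := by
  refine fun v hv => mem_ckVectors_iff.2 ⟨?_, fun e he m hm => ?_⟩
  · exact hcont.comp (f := fun g : G => (g, v)) (by fun_prop)
  have hmul := hexp.isMultilinear_iteratedGenerator hπ hcont hv
  have hC := tangentCkOn_of_multilinear e.open_target (k := n)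
    (D := fun j x y => π (e.symm x) (iteratedGenerator π exp v j y)) (κ := leftLogDeriv e)
    (hG.tangentCkOn_leftLogDeriv he) ?_ ?_ ?_ n 0 (by omega)
  · refine TangentCkOn.of_le (by exact_mod_cast hm) ?_
    exact (hC.comp_clm (e.open_target.prod isOpen_univ)
      (ContinuousLinearMap.inl ℝ E (Fin 0 → E))).mono fun x hx => ⟨hx, trivial⟩
  · intro j hj x _
    obtain ⟨M, hM⟩ := hmul j hj
    exact ⟨((π (e.symm x)).toLinearEquiv.toLinearMap.restrictScalars ℝ).compMultilinearMap M,
      fun y => by simp [hM]⟩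
  · intro j hj x hx y h
    simp only [iteratedGenerator_snoc]
    exact hG.hasDirDerivAt_orbit hexp hπ hcont
      (iteratedGenerator_mem_generatorDomain hj hv y) he hx h
  · intro j hj
    have hc := (hmul j hj).continuous_of_separately
      (hexp.continuous_iteratedGenerator_update hπ hcont hv j hj)
    exact hcont.comp_continuousOn (ContinuousOn.prodMk
      (e.continuousOn_symm.comp continuousOn_fst fun p hp => hp.1)
      (hc.comp continuous_snd).continuousOn)

theorem ckVectors_mono {k l : ℕ∞} (hkl : k ≤ l) :
    ckVectors E π l ⊆ ckVectors E π k := fun _ hv =>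
  mem_ckVectors_iff.2 ⟨(mem_ckVectors_iff.1 hv).1, fun e he n hn =>
    (mem_ckVectors_iff.1 hv).2 e he n (hn.trans hkl)⟩

/-- Adding a time variable t turns the generator into a partial derivative of a C^{n+1}-map;
evaluating its tangent map at t = 0 in the direction (0, 1) costs one order. -/
theorem IsLCLieGroup.generator_mem_ckVectors (hG : IsLCLieGroup E G) (hexp : IsExponential exp)
    (hcont : Continuous fun p : G × H => π p.1 p.2) {n : ℕ} {v : H}
    (hv : v ∈ ckVectors E π (n + 1 : ℕ)) (y : E) :
    generator π exp y v ∈ ckVectors E π n := by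
  refine mem_ckVectors_iff.2 ⟨hcont.comp (f := fun g : G => (g, _)) (by fun_prop),
    fun e he m hm => TangentCkOn.of_le (by exact_mod_cast hm) ?_⟩
  have hO : IsOpen (e.target ×ˢ (Set.univ : Set ℝ)) := e.open_target.prod isOpen_univ
  have hf : IsSmoothInto E (fun p : E × ℝ => e.symm p.1 * exp (p.2 • y))
      (e.target ×ˢ (Set.univ : Set ℝ)) :=
    hG.isSmoothInto_mul hO
      (((hG.isSmoothInto_symm he).comp_clm e.open_target (ContinuousLinearMap.fst ℝ E ℝ)).mono
        fun p hp => hp.1)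
      ((hexp.isSmoothInto.comp_clm isOpen_univ
        ((ContinuousLinearMap.snd ℝ E ℝ).smulRight y)).mono fun p _ => trivial)
  have hC := tangentCkOn_orbit hv (n := n + 1) le_rfl hO hf
  have hline : TangentCkOn n (fun x : E => ((x, (0 : ℝ)), ((0 : E), (1 : ℝ)))) e.target :=
    TangentCkOn.prodMk e.open_target
      (tangentCkOn_clm n (ContinuousLinearMap.inl ℝ E ℝ) _ e.open_target)
      (tangentCkOn_const n ((0 : E), (1 : ℝ)) _ e.open_target)
  refine (hC.2.2.comp e.open_target (hO.prod isOpen_univ) hline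
    fun x hx => ⟨⟨hx, trivial⟩, trivial⟩).congr e.open_target fun x _ => ?_
  refine HasDirDerivAt.dirDeriv_eq ?_
  have hv1 : v ∈ ckVectors E π 1 := ckVectors_mono (by simp) hv
  have h1 := hexp.hasDerivAt_iff.1 (hasDerivAt_generator (hexp.mem_generatorDomain hv1 y))
  have h2 := ((π (e.symm x)).continuous.tendsto _).comp h1
  refine Tendsto.congr (fun t => ?_) h2
  simp [rep_smul, hexp.map_zero]

theorem IsLCLieGroup.ckVectors_subset_generatorDomains (hG : IsLCLieGroup E G)
    (hexp : IsExponential exp) (hcont : Continuous fun p : G × H => π p.1 p.2) (n : ℕ) :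
    ckVectors E π n ⊆ generatorDomains π exp n := by
  induction n with
  | zero => exact Set.subset_univ _
  | succ n ih =>
    refine fun v hv => ⟨Set.mem_iInter.2 fun y => ?_, fun y => ?_⟩
    · exact hexp.mem_generatorDomain (ckVectors_mono (by simp) hv) y
    · exact ih (hG.generator_mem_ckVectors hexp hcont hv y)

theorem iInter_ckVectors : ⋂ n : ℕ, ckVectors E π n = ckVectors E π ⊤ := by
  refine Set.Subset.antisymm (fun v hv => ?_) (Set.subset_iInter fun n => ckVectors_mono le_top)
  rw [Set.mem_iInter] at hv
  exact mem_ckVectors_iff.2 ⟨(mem_ckVectors_iff.1 (hv 0)).1, fun e he n _ =>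
    (mem_ckVectors_iff.1 (hv n)).2 e he n le_rfl⟩

end OrbitMaps

theorem mainTheorem4 {E G H : Type*}
    -- the Fréchet space `E`, the model space and Lie algebra of `G`
    [AddCommGroup E] [Module ℝ E] [UniformSpace E] [IsUniformAddGroup E] [ContinuousSMul ℝ E]
    [LocallyConvexSpace ℝ E] [CompleteSpace E] [TopologicalSpace.MetrizableSpace E]
    -- the Fréchet–Lie group `G` with the Trotter property
    [Group G] [TopologicalSpace G] [IsTopologicalGroup G] [T2Space G] [ChartedSpace E G]
    (hG : IsLCLieGroup E G) (exp : E → G) (hexp : HasTrotterProperty exp)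
    -- the differentiable unitary representation `π` on the Hilbert space `H`
    [NormedAddCommGroup H] [InnerProductSpace ℂ H] [CompleteSpace H]
    (π : G →* (H ≃ₗᵢ[ℂ] H)) (hπ : Dense (ckVectors E π 1)) :
    (∀ n : ℕ, generatorDomains π exp n = ckVectors E π n) ∧
      (⋂ n : ℕ, generatorDomains π exp n) = ckVectors E π ⊤ := by
  -- With completeness this makes `E` a Baire space, hence barrelled.
  have : (uniformity E).IsCountablyGenerated := IsUniformAddGroup.uniformity_countably_generated
  have hcont : Continuous fun p : G × H => π p.1 p.2 :=
    continuous_rep hπ fun w hw => (mem_ckVectors_iff.1 hw).1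
  have h1 : ∀ n : ℕ, generatorDomains π exp n = ckVectors E π n := fun n =>
    (hG.generatorDomains_subset_ckVectors hexp.isExponential hπ hcont n).antisymm
      (hG.ckVectors_subset_generatorDomains hexp.isExponential hcont n)
  exact ⟨h1, by simp only [h1, iInter_ckVectors]⟩
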